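/- Let $O=\sum_{q=1}^N o_qZ_q$ be an observable on $N$ qubits, where $Z_q$ is the Pauli matrix $Z$ on qubit $q$ and the identity elsewhere. Let $1\le S\le N$ and let $\mathcal Q$ be a non-empty family of $S$-element subsets of $\{1,\dots,N\}$. Let $V(\theta)=e^{-iH_D\theta_D/2}\cdots e^{-iH_1\theta_1/2}$, where the Hamiltonians $H_1,\dots,H_D$ are independent and random: $H_d$ acts on a qubit group $\mathcal S_d\in\mathcal Q$ and, given $\mathcal S_d$, is uniform on the $3^S$ elements of $\{X,Y,Z\}^{\otimes S}$ on these qubits; the groups are equidistributed in $\mathcal Q$, in the sense that $\frac1D\sum_{d}\mathbb P(\mathcal S_d=s)=\frac1{|\mathcal Q|}$ for every $s\in\mathcal Q$ (for example, all $\mathcal S_d$ are uniform on $\mathcal Q$, or they are fixed and each group is used equally often). Let $\mathcal A$ be a finite index set and $\rho_a$, $a\in\mathcal A$, independent and identically distributed random states, independent of the circuit, with $\rho_a=2^{-N}\sum_{\boldsymbol p\in\{0,1,2,3\}^N}A_{\boldsymbol pa}\sigma_{\boldsymbol p}$, where $\sigma_{\boldsymbol p}$ are the Pauli strings ($0,1,2,3$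 stand for $I,X,Y,Z$), and suppose that for all $\boldsymbol i,\boldsymbol j\ne\boldsymbol 0$ and $a,b\in\mathcal A$ $$\mathbb E A_{\boldsymbol ia}=0,\qquad \mathbb E A_{\boldsymbol ia}A_{\boldsymbol jb}=\alpha_{\boldsymbol i}\delta_{\boldsymbol i\boldsymbol j}\delta_{ab}.$$ Let $R_{\mathcal Q}$ be the set of the $(3^S-1)|\mathcal Q|$ indices $\boldsymbol p$ whose set of non-zero positions belongs to $\mathcal Q$ and which have fewer than $S$ entries equal to $3$. Assume $\alpha_{\boldsymbol p}>0$ on $R_{\mathcal Q}$, let $\alpha_{\max},\alpha_{\min}$ be the maximum and minimum of $\alpha$ over $R_{\mathcal Q}$, and let $A'_{\max}$ and $A'_{\min}$ be the maximum and minimum over $a\in\mathcal A$ of $$\Big(\frac1{(3^S-1)|\mathcal Q|}\sum_{\boldsymbol p\in R_{\mathcal Q}}\frac{A_{\boldsymbol pa}^2}{\alpha_{\boldsymbol p}}\Big)^{1/2}.$$ Let $\Delta_S=\min\{(\boldsymbol g^T\boldsymbol o)^2:\boldsymbol g\in\{0,\pm1\}^N,\ 1\le\|\boldsymbol g\|_1\le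 S\}$ and assume $\Delta_S>0$. Let $z_a(\theta)=\mathrm{Tr}[OV(\theta)\rho_aV(\theta)^\dagger]$, $J_{da}=\partial z_a/\partial\theta_d$, and let $K(\theta)=\frac1DJ(\theta)^TJ(\theta)$ be the quantum neural tangent kernel. There are absolute constants $n_0$ and $C_1,C_2>0$ such that, whenever $|\mathcal A|\ge n_0$, for all $\delta,k\in(0,1)$ the following holds with probability at least $1-\delta$. If $A'_{\min}>0$, $$D\ge D_0\ln\frac{D_0}\delta\quad\text{with}\quad D_0=C_2\,\frac{\|O\|_2^4\,\alpha_{\max}^2A_{\max}'^2}{k^2\Delta_S^2\,\alpha_{\min}^2A_{\min}'^4}\,|\mathcal A|\ln\frac{|\mathcal A|}\delta ,$$ and $$S\ge\log_3\Big[1+\frac{C_1^2|\mathcal A|^2\ln|\mathcal A|}{k^2A_{\min}'^4|\mathcal Q|\delta^2}\Big],$$ then every eigenvalue $\lambda$ of $K(\boldsymbol 0)$ satisfies $$(1-k)\,\frac{3^S-1}{3^S}\,\Delta_S\,\alpha_{\min}A_{\min}'^2\ \le\ \lambda\ \le\ (1+k)\,\|O\|_2^2\,\alpha_{\max}A_{\max}'^2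 ,$$ and, if in addition $|\mathcal Q|\le|\mathcal A|^2\ln|\mathcal A|$ or $3^S\ge 2/k$, also $$(1-k)\,\Delta_S\,\alpha_{\min}A_{\min}'^2\ \le\ \lambda .$$ -/

import Mathlib

open MeasureTheory ProbabilityTheory
open scoped ComplexOrder

noncomputable section

namespace QNTK

/-- Matrices acting on `N` qubits; the computational basis is indexed by bit strings. -/
abbrev QMat (N : ℕ) : Type := Matrix (Fin N → Fin 2) (Fin N → Fin 2) ℂ

/-- Indices of Pauli strings: `0, 1, 2, 3` stand for `I, X, Y, Z`. -/
abbrev PauliString (N : ℕ) : Type := Fin N → Fin 4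

/-- The single-qubit matrices `I, X, Y, Z`. -/
def pauli : Fin 4 → Matrix (Fin 2) (Fin 2) ℂ :=
  ![1, !![0, 1; 1, 0], !![0, -Complex.I; Complex.I, 0], !![1, 0; 0, -1]]

/-- The tensor product of the Pauli matrices listed in `p`. -/
def pauliTensor {N : ℕ} (p : PauliString N) : QMat N :=
  Matrix.of fun x y => ∏ q, pauli (p q) (x q) (y q)

/-- The qubits on which a Pauli string acts nontrivially. -/
def supp {N : ℕ} (p : PauliString N) : Finset (Fin N) :=
  Finset.univ.filter fun q => p q ≠ 0

/-- `Z` on qubit `q` and the identity elsewhere. -/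
def pauliZ {N : ℕ} (q : Fin N) : QMat N :=
  pauliTensor (Pi.single q 3)

/-- The observable `∑ₖ oₖ Zₖ`. -/
def observable {N : ℕ} (o : Fin N → ℝ) : QMat N :=
  ∑ q, (o q : ℂ) • pauliZ q

/-- The spectral norm, i.e. the operator norm on `ℂ^(2^N)` with its Euclidean norm. -/
def specNorm {N : ℕ} (M : QMat N) : ℝ :=
  ‖Matrix.toEuclideanCLM (n := Fin N → Fin 2) (𝕜 := ℂ) M‖

/-- Quantum states: positive semidefinite matrices of trace one. -/
def IsState {N : ℕ} (ρ : QMat N) : Prop :=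
  ρ.PosSemidef ∧ ρ.trace = 1

/-- The gate `exp(-i H t / 2)`. -/
def gate {N : ℕ} (H : QMat N) (t : ℝ) : QMat N :=
  NormedSpace.exp ((-(Complex.I * (t : ℂ)) / 2) • H)

/-- The circuit `V(θ) = exp(-i H_D θ_D / 2) ⋯ exp(-i H_1 θ_1 / 2)`
(the gate with index `0` acts first). -/
def circuit {N D : ℕ} (H : Fin D → QMat N) (θ : Fin D → ℝ) : QMat N :=
  (List.ofFn fun d => gate (H d) (θ d)).reverse.prod

/-- The prediction `Tr[O V(θ) ρ V(θ)†]`; the trace is real for Hermitian `O` and `ρ`. -/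
def prediction {N D : ℕ} (O : QMat N) (H : Fin D → QMat N) (ρ : QMat N)
    (θ : Fin D → ℝ) : ℝ :=
  (O * circuit H θ * ρ * (circuit H θ).conjTranspose).trace.re

/-- The Jacobian `J_{da}(θ) = ∂ z_a / ∂ θ_d`. -/
def jacobian {N D n : ℕ} (O : QMat N) (H : Fin D → QMat N) (ρ : Fin n → QMat N)
    (θ : Fin D → ℝ) : Matrix (Fin D) (Fin n) ℝ :=
  Matrix.of fun d a =>
    deriv (fun t : ℝ => prediction O H (ρ a) (Function.update θ d t)) (θ d)

/-- The quantum neural tangent kernel `K(θ) = (1/D) J(θ)ᵀ J(θ)`. -/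
def qntk {N D n : ℕ} (O : QMat N) (H : Fin D → QMat N) (ρ : Fin n → QMat N)
    (θ : Fin D → ℝ) : Matrix (Fin n) (Fin n) ℝ :=
  (1 / (D : ℝ)) • ((jacobian O H ρ θ).transpose * jacobian O H ρ θ)

/-- The Pauli coefficient `A_p = Tr[σ_p ρ]`, so that `ρ = ∑_p 2^(-N) A_p σ_p`. -/
def pauliCoeff {N : ℕ} (ρ : QMat N) (p : PauliString N) : ℝ :=
  (pauliTensor p * ρ).trace.re

/-- Row indices of `A_Q`: Pauli strings whose set of nontrivial qubits is one of the (size `S`)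
qubit groups in `Q`, with `w ∈ {0, …, S - 1}` factors `Z`. -/
def rows {N : ℕ} (Q : Finset (Finset (Fin N))) (S : ℕ) : Finset (PauliString N) :=
  Finset.univ.filter fun p =>
    supp p ∈ Q ∧ (Finset.univ.filter fun q => p q = 3).card < S

/-- `α_max`, the largest variance over the rows of `A_Q`. -/
def alphaMax {N : ℕ} (Q : Finset (Finset (Fin N))) (S : ℕ) (α : PauliString N → ℝ) : ℝ :=
  sSup (α '' (rows Q S : Set (PauliString N)))

/-- `α_min`, the smallest variance over the rows of `A_Q`. -/
def alphaMin {N : ℕ} (Q : Finset (Finset (Fin N))) (S : ℕ) (α : PauliString N → ℝ) : ℝ :=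
  sInf (α '' (rows Q S : Set (PauliString N)))

/-- The matrix `A'_Q = Var_Q^(-1/2) A_Q`. -/
def normalizedCoeff {N n : ℕ} (Q : Finset (Finset (Fin N))) (S : ℕ)
    (α : PauliString N → ℝ) (ρ : Fin n → QMat N) : Matrix (rows Q S) (Fin n) ℝ :=
  Matrix.of fun p a => pauliCoeff (ρ a) p / Real.sqrt (α p)

/-- The norm of column `a` of `A'_Q`, divided by `√((3^S - 1)|Q|)`. -/
def columnNorm {N n : ℕ} (Q : Finset (Finset (Fin N))) (S : ℕ)
    (α : PauliString N → ℝ) (ρ : Fin n → QMat N) (a : Fin n) : ℝ :=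
  1 / Real.sqrt (((3 : ℝ) ^ S - 1) * Q.card) *
    Real.sqrt (∑ p, normalizedCoeff Q S α ρ p a ^ 2)

/-- `A'_{Q,max}`. -/
def colMax {N n : ℕ} (Q : Finset (Finset (Fin N))) (S : ℕ)
    (α : PauliString N → ℝ) (ρ : Fin n → QMat N) : ℝ :=
  ⨆ a, columnNorm Q S α ρ a

/-- `A'_{Q,min}`. -/
def colMin {N n : ℕ} (Q : Finset (Finset (Fin N))) (S : ℕ)
    (α : PauliString N → ℝ) (ρ : Fin n → QMat N) : ℝ :=
  ⨅ a, columnNorm Q S α ρ a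

/-- `Δ_S`, the minimum of `(g · o)²` over `g ∈ {0, ±1}^N` with `1 ≤ ‖g‖₁ ≤ S`. -/
def Delta {N : ℕ} (o : Fin N → ℝ) (S : ℕ) : ℝ :=
  sInf {x : ℝ | ∃ g : Fin N → ℤ, (∀ q, |g q| ≤ 1) ∧ 1 ≤ ∑ q, |g q| ∧ ∑ q, |g q| ≤ (S : ℤ) ∧
    x = (∑ q, (g q : ℝ) * o q) ^ 2}

/-- The data distribution: the random states `ρ a` are independent and identically distributed,
and their Pauli coefficients (except the trivial one) are centred and pairwise uncorrelated, with
variances `α i`. -/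
structure IsUncorrelatedEnsemble {Ω : Type*} [MeasurableSpace Ω] (μ : Measure Ω) {N n : ℕ}
    (ρ : Fin n → Ω → QMat N) (α : PauliString N → ℝ) : Prop where
  measurable : ∀ a x y, Measurable fun ω => ρ a ω x y
  state : ∀ a, ∀ᵐ ω ∂μ, IsState (ρ a ω)
  indep : iIndepFun (fun a ω => fun x y => ρ a ω x y) μ
  ident : ∀ a b, IdentDistrib (fun ω => fun x y => ρ a ω x y) (fun ω => fun x y => ρ b ω x y) μ μ
  mean : ∀ a i, i ≠ 0 → ∫ ω, pauliCoeff (ρ a ω) i ∂μ = 0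
  cov : ∀ a b i j, i ≠ 0 → j ≠ 0 →
    ∫ ω, pauliCoeff (ρ a ω) i * pauliCoeff (ρ b ω) j ∂μ = if i = j ∧ a = b then α i else 0

/-- The random gates: gate `d` has Hamiltonian `σ_{P d}`, which acts on the qubit group
`S_d = supp (P d) ∈ Q`. The gates are independent; given `S_d`, the Hamiltonian is uniform on the
`3 ^ S` strings in `{X, Y, Z}^{⊗S}` on these qubits; on average over the `D` gates the groups of
`Q` are used equally often. The last condition holds when all `S_d` are uniform on `Q`, and also
when the `S_d` are fixed and each group is used by the same number of gates. -/
structure IsRandomCircuit {Ω : Type*} [MeasurableSpace Ω] (μ : Measure Ω) {N D : ℕ}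
    (Q : Finset (Finset (Fin N))) (S : ℕ) (P : Fin D → Ω → PauliString N) : Prop where
  measurable : ∀ d, Measurable (P d)
  supp_mem : ∀ d ω, supp (P d ω) ∈ Q
  indep : iIndepFun P μ
  hamiltonian : ∀ d p, supp p ∈ Q →
    μ.real {ω | P d ω = p} = μ.real {ω | supp (P d ω) = supp p} / 3 ^ S
  groups : ∀ s ∈ Q, ∑ d, μ.real {ω | supp (P d ω) = s} = (D : ℝ) / Q.card

/-- `D₀ = C₂ ‖O‖⁴ α_max² A'_max² / (k² Δ_S² α_min² A'_min⁴) |𝒜| ln(|𝒜| / δ)`. -/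
def depthScale {N n : ℕ} (C₂ δ k : ℝ) (o : Fin N → ℝ) (Q : Finset (Finset (Fin N))) (S : ℕ)
    (α : PauliString N → ℝ) (ρ : Fin n → QMat N) : ℝ :=
  C₂ * (specNorm (observable o) ^ 4 * alphaMax Q S α ^ 2 * colMax Q S α ρ ^ 2 /
    (k ^ 2 * Delta o S ^ 2 * alphaMin Q S α ^ 2 * colMin Q S α ρ ^ 4)) *
    n * Real.log (n / δ)

/-- The requirements on the number of gates `D` and on the number `S` of qubits of a gate, which
involve the data through `A'_{Q,min}` and `A'_{Q,max}`. As these requirements divide by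
`A'_{Q,min}`, they can only be met when it is positive. -/
def SizeConditions {N n : ℕ} (C₁ C₂ δ k : ℝ) (D : ℕ) (o : Fin N → ℝ)
    (Q : Finset (Finset (Fin N))) (S : ℕ) (α : PauliString N → ℝ) (ρ : Fin n → QMat N) : Prop :=
  0 < colMin Q S α ρ ∧
  depthScale C₂ δ k o Q S α ρ * Real.log (depthScale C₂ δ k o Q S α ρ / δ) ≤ (D : ℝ) ∧
  Real.logb 3 (1 + C₁ ^ 2 * (n : ℝ) ^ 2 * Real.log n /
    (k ^ 2 * colMin Q S α ρ ^ 4 * Q.card * δ ^ 2)) ≤ (S : ℝ)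

end QNTK

end

/-!
At the trivial circuit `J_{da}` depends on the gate `d` only through its Pauli string: it is
`(B A_a)(P_d)`, where `A_a` is the vector of Pauli coefficients of the state `ρ_a` and `B`
(`derivOp`) is the linear map `u ↦ ∑_q o_q (± u ∘ flip_q)`, in which `flip_q` exchanges `X` and `Y`
on qubit `q` (`jacobian_zero`). Hence `K(0) = ∑_p (N_p / D) (B A)_p (B A)_pᵀ`, with `N_p` the number
of gates whose string is `p`, and three facts bound its spectrum.

* The counts. There are `3 ^ S |Q|` possible strings, each of which occurs `D / (3 ^ S |Q|)` times
  on average, so by Chernoff's inequality and a union bound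
  (`measure_exists_count_deviation_le`) all counts are within a relative error `k / 4` of their
  means once `D` is at least `64 · 3 ^ S |Q| log (4 · 3 ^ S |Q| / δ) / k²`. The kernel is then, in
  the Loewner order, within the same relative error of its mean over the circuits; no matrix
  concentration is needed.
* The observable. The summands of `B` commute, and tensor products of `I, X ± iY, Z` diagonalise
  them, with eigenvalues `0, ±i`. On the rows of `A_Q` the singular values of `B` are therefore of
  the form `|g · o|` with `1 ≤ ‖g‖₁ ≤ S`, and lie between `√Δ_S` and `∑ |o_q| ≤ ‖O‖`
  (`sum_derivOp_sq_bounds`, `sum_abs_le_specNorm`).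
* The data. The off-diagonal entries of the Gram matrix of the normalised columns have second moment
  `(3 ^ S - 1) |Q|`, so by Markov's inequality its off-diagonal part has a small Frobenius norm
  (`measure_offDiag_gram_le`), which the condition on `S` makes at most `k / 4` times the smallest
  diagonal entry.

It remains to see that the required depth exceeds `64 · 3 ^ S |Q| / k²` (`card_div_le_depthScale`).
Since no nonzero `{0, ±1}`-combination of at most `S` of the `o_q` has absolute value below `√Δ_S`,
the sums of `|o_q|` over sets of `⌊S / 2⌋` qubits are `√Δ_S`-separated. For `S ≥ 2` averaging them
gives a lower bound on `W = ∑ |o_q| / √Δ_S` by binomial coefficients (`choose_mul_choose_le`), and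
for `S = 1` already `W ≥ N`; in both cases `(3 ^ S |Q|) ^ 9 ≤ 160 ^ 16 · W ^ 32` (`card_pow_le`).
As `‖O‖⁴ / Δ_S² ≥ W⁴`, this suffices unless the smallest squared column norm
`B = A'_min²` is large. But the product of the squared column norms of the `n` independent states
has mean one, so that `B ^ n < 4 / δ` with high probability (`measure_prod_gram_le`); together with
the condition on `S` this yields `B ^ 8 ≤ 16 · 3 ^ S |Q|` (`pow_eight_le`), which the spare power in
`card_pow_le` absorbs.
-/

namespace QNTK

/-! ### The Jacobian at the trivial circuit -/

/-- The tensor product of a family of single-qubit matrices. -/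
def tensor {N : ℕ} (A : Fin N → Matrix (Fin 2) (Fin 2) ℂ) : QMat N :=
  Matrix.of fun x y => ∏ q, A q (x q) (y q)

lemma tensor_mul {N : ℕ} (A B : Fin N → Matrix (Fin 2) (Fin 2) ℂ) :
    tensor A * tensor B = tensor fun q => A q * B q := by
  ext x y
  simp only [tensor, Matrix.mul_apply, Matrix.of_apply, ← Finset.prod_mul_distrib]
  rw [Finset.prod_univ_sum, Fintype.piFinset_univ]

lemma tensor_update_apply {N : ℕ} (A : Fin N → Matrix (Fin 2) (Fin 2) ℂ) (q : Fin N)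
    (M : Matrix (Fin 2) (Fin 2) ℂ) (x y : Fin N → Fin 2) :
    tensor (Function.update A q M) x y =
      M (x q) (y q) * ∏ r ∈ Finset.univ.erase q, A r (x r) (y r) := by
  simp only [tensor, Matrix.of_apply]
  rw [← Finset.mul_prod_erase _ _ (Finset.mem_univ q)]
  congr 1
  · simp
  · refine Finset.prod_congr rfl fun r hr => ?_
    rw [Function.update_of_ne (Finset.ne_of_mem_erase hr)]

lemma pauliTensor_eq_tensor {N : ℕ} (p : PauliString N) :
    pauliTensor p = tensor fun q => pauli (p q) := rfl

lemma pauliZ_eq_tensor {N : ℕ} (q : Fin N) :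
    pauliZ q = tensor (Function.update (fun _ => 1) q (pauli 3)) := by
  rw [pauliZ, pauliTensor_eq_tensor]
  congr 1
  funext r
  by_cases h : r = q
  · subst h; simp
  · simp [h, pauli]

/-- The permutation of the Pauli indices that exchanges `X` and `Y`. -/
def swapXY : Fin 4 → Fin 4 := ![0, 2, 1, 3]

/-- The sign in `(i/2) [σ, Z]`, which is `Y` for `σ = X`, `-X` for `σ = Y` and `0` otherwise. -/
def signXY : Fin 4 → ℝ := ![0, 1, -1, 0]

/-- Exchange `X` and `Y` at position `q` of a Pauli string. -/
def flip {N : ℕ} (q : Fin N) (p : PauliString N) : PauliString N :=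
  Function.update p q (swapXY (p q))

lemma swapXY_swapXY (i : Fin 4) : swapXY (swapXY i) = i := by
  fin_cases i <;> rfl

lemma commutator_pauli (i : Fin 4) :
    (Complex.I / 2) • (pauli i * pauli 3 - pauli 3 * pauli i) =
      (signXY i : ℂ) • pauli (swapXY i) := by
  fin_cases i <;> ext a b <;> fin_cases a <;> fin_cases b <;>
    simp [pauli, signXY, swapXY] <;> ring_nf <;>
    simp [Complex.I_sq]

/-- The commutator with `Z` on qubit `q` maps a Pauli string to a multiple of another one. -/
lemma commutator_pauliTensor {N : ℕ} (p : PauliString N) (q : Fin N) :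
    (Complex.I / 2) • (pauliTensor p * pauliZ q - pauliZ q * pauliTensor p) =
      (signXY (p q) : ℂ) • pauliTensor (flip q p) := by
  have h1 : pauliTensor p * pauliZ q =
      tensor (Function.update (fun r => pauli (p r)) q (pauli (p q) * pauli 3)) := by
    rw [pauliZ_eq_tensor, pauliTensor_eq_tensor, tensor_mul]
    congr 1
    funext r
    by_cases h : r = q
    · subst h; simp
    · simp [h]
  have h2 : pauliZ q * pauliTensor p =
      tensor (Function.update (fun r => pauli (p r)) q (pauli 3 * pauli (p q))) := by
    rw [pauliZ_eq_tensor, pauliTensor_eq_tensor, tensor_mul]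
    congr 1
    funext r
    by_cases h : r = q
    · subst h; simp
    · simp [h]
  have h3 : pauliTensor (flip q p) =
      tensor (Function.update (fun r => pauli (p r)) q (pauli (swapXY (p q)))) := by
    rw [pauliTensor_eq_tensor]
    congr 1
    funext r
    by_cases h : r = q
    · subst h; simp [flip]
    · simp [flip, h]
  rw [h1, h2, h3]
  ext x y
  have h := congrFun (congrFun (commutator_pauli (p q)) (x q)) (y q)
  simp only [Matrix.smul_apply, Matrix.sub_apply, smul_eq_mul, tensor_update_apply] at h ⊢
  rw [← mul_assoc (signXY (p q) : ℂ), ← h]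
  ring

lemma pauli_conjTranspose (i : Fin 4) : (pauli i).conjTranspose = pauli i := by
  fin_cases i <;> ext a b <;> fin_cases a <;> fin_cases b <;> simp [pauli]

lemma pauliTensor_conjTranspose {N : ℕ} (p : PauliString N) :
    (pauliTensor p).conjTranspose = pauliTensor p := by
  ext x y
  simp only [pauliTensor, Matrix.conjTranspose_apply, Matrix.of_apply, star_prod]
  refine Finset.prod_congr rfl fun q _ => ?_
  exact congrFun (congrFun (pauli_conjTranspose (p q)) (x q)) (y q)

lemma reverse_ofFn_prod_eq {M : Type*} [Monoid M] {D : ℕ} (f : Fin D → M) (d : Fin D)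
    (h : ∀ i, i ≠ d → f i = 1) : (List.ofFn f).reverse.prod = f d := by
  induction D with
  | zero => exact d.elim0
  | succ D ih =>
    rw [List.ofFn_succ, List.reverse_cons, List.prod_append, List.prod_singleton]
    refine Fin.cases (fun h => ?_) (fun j h => ?_) d h
    · have : (List.ofFn fun i : Fin D => f i.succ) = List.replicate D 1 := by
        rw [← List.ofFn_const]
        congr 1
        funext i
        exact h _ (Fin.succ_ne_zero i)
      simp [this]
    · rw [ih (fun i => f i.succ) j fun i hi => h _ fun e => hi (Fin.succ_injective _ e),
        h 0 (Fin.succ_ne_zero j).symm, mul_one]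

lemma gate_zero {N : ℕ} (H : QMat N) : gate H 0 = 1 := by
  simp [gate, NormedSpace.exp_zero]

lemma circuit_update_zero {N D : ℕ} (H : Fin D → QMat N) (d : Fin D) (t : ℝ) :
    circuit H (Function.update 0 d t) = gate (H d) t := by
  rw [circuit, reverse_ofFn_prod_eq _ d]
  · simp
  · intro i hi
    simp [Function.update_of_ne hi, gate_zero]

lemma gate_eq_exp_smul {N : ℕ} (H : QMat N) (t : ℝ) :
    gate H t = NormedSpace.exp (t • ((-Complex.I / 2) • H)) := by
  rw [gate]
  congr 1
  ext x y
  simp only [Matrix.smul_apply, smul_eq_mul, Complex.real_smul]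
  ring

lemma gate_conjTranspose {N : ℕ} {H : QMat N} (hH : H.conjTranspose = H) (t : ℝ) :
    (gate H t).conjTranspose = NormedSpace.exp (t • ((Complex.I / 2) • H)) := by
  rw [gate, ← Matrix.exp_conjTranspose, Matrix.conjTranspose_smul, hH]
  congr 1
  ext x y
  simp only [Matrix.smul_apply, smul_eq_mul, Complex.real_smul, star_div₀, star_neg, star_mul',
    Complex.star_def, Complex.conj_I, Complex.conj_ofReal, map_ofNat]
  ring

lemma hasDerivAt_conj_exp {𝔸 : Type*} [NormedRing 𝔸] [NormedAlgebra ℝ 𝔸]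
    [FiniteDimensional ℝ 𝔸] (L : 𝔸 →ₗ[ℝ] ℝ) (O ρ X Y : 𝔸) :
    HasDerivAt (fun t : ℝ => L (O * NormedSpace.exp (t • X) * ρ * NormedSpace.exp (t • Y)))
      (L (O * X * ρ + O * ρ * Y)) 0 := by
  have : CompleteSpace 𝔸 := FiniteDimensional.complete ℝ 𝔸
  have h1 := hasDerivAt_exp_smul_const (𝕂 := ℝ) X (0 : ℝ)
  have h2 := hasDerivAt_exp_smul_const (𝕂 := ℝ) Y (0 : ℝ)
  have h3 := ((h1.const_mul O).mul_const ρ).mul h2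
  have h4 := (LinearMap.toContinuousLinearMap L).hasFDerivAt.comp_hasDerivAt (0 : ℝ) h3
  refine HasDerivAt.congr_deriv h4 ?_
  simp [NormedSpace.exp_zero]

section Derivative

attribute [local instance] Matrix.linftyOpNormedRing Matrix.linftyOpNormedAlgebra

/-- The derivative at `0` of a prediction of a single gate, with the commutator moved onto the
observable. -/
lemma hasDerivAt_trace_gate {N : ℕ} {H : QMat N} (hH : H.conjTranspose = H) (O ρ : QMat N) :
    HasDerivAt (fun t : ℝ => (O * gate H t * ρ * (gate H t).conjTranspose).trace.re)
      ((((Complex.I / 2) • (H * O - O * H)) * ρ).trace.re) 0 := by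
  let L : QMat N →ₗ[ℝ] ℝ := Complex.reLm ∘ₗ (Matrix.traceLinearMap (Fin N → Fin 2) ℝ ℂ)
  have h := hasDerivAt_conj_exp (𝔸 := QMat N) L O ρ ((-Complex.I / 2) • H) ((Complex.I / 2) • H)
  have e : (fun t : ℝ => (O * gate H t * ρ * (gate H t).conjTranspose).trace.re) = fun t : ℝ =>
      L (O * NormedSpace.exp (t • ((-Complex.I / 2) • H)) * ρ *
        NormedSpace.exp (t • ((Complex.I / 2) • H))) := by
    funext t
    rw [gate_conjTranspose hH, gate_eq_exp_smul]
    rfl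
  rw [e]
  refine HasDerivAt.congr_deriv h ?_
  refine congrArg Complex.re (?_ : Matrix.trace (O * ((-Complex.I / 2) • H) * ρ +
    O * ρ * ((Complex.I / 2) • H)) = _)
  simp only [Matrix.trace_add, Matrix.smul_mul, Matrix.mul_smul, Matrix.trace_smul, Matrix.sub_mul,
    Matrix.trace_sub, smul_eq_mul]
  rw [Matrix.trace_mul_comm (O * ρ) H, ← Matrix.mul_assoc]
  ring

end Derivative

/-- The derivative of the prediction with respect to one gate at the trivial circuit, as an
operator on the vector of Pauli coefficients of the state: its value at `p` is the derivative for a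
gate with Hamiltonian `σ_p`. -/
def derivOp {N : ℕ} (o : Fin N → ℝ) (u : PauliString N → ℝ) (p : PauliString N) : ℝ :=
  ∑ q, o q * signXY (p q) * u (flip q p)

lemma jacobian_zero {N D n : ℕ} (o : Fin N → ℝ) (P : Fin D → PauliString N)
    (ρ : Fin n → QMat N) (d : Fin D) (a : Fin n) :
    jacobian (observable o) (fun d => pauliTensor (P d)) ρ 0 d a =
      derivOp o (pauliCoeff (ρ a)) (P d) := by
  have h := hasDerivAt_trace_gate (pauliTensor_conjTranspose (P d)) (observable o) (ρ a)
  simp only [jacobian, Matrix.of_apply, prediction, circuit_update_zero, Pi.zero_apply]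
  rw [h.deriv]
  have h2 : (Complex.I / 2) • (pauliTensor (P d) * observable o - observable o * pauliTensor (P d))
      = ∑ q, (o q : ℂ) • (signXY (P d q) : ℂ) • pauliTensor (flip q (P d)) := by
    simp only [← commutator_pauliTensor, observable, Finset.mul_sum, Finset.sum_mul,
      ← Finset.sum_sub_distrib, Finset.smul_sum, Matrix.mul_smul, Matrix.smul_mul, ← smul_sub]
    exact Finset.sum_congr rfl fun q _ => smul_comm _ _ _
  rw [h2, Finset.sum_mul, Matrix.trace_sum, Complex.re_sum, derivOp]
  refine Finset.sum_congr rfl fun q _ => ?_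
  rw [smul_smul, Matrix.smul_mul, Matrix.trace_smul, ← Complex.ofReal_mul, smul_eq_mul,
    Complex.re_ofReal_mul]
  rfl

/-! ### Diagonalisation of the derivative operator -/

lemma flip_flip {N : ℕ} (q : Fin N) (p : PauliString N) : flip q (flip q p) = p := by
  simp [flip, swapXY_swapXY]

lemma flip_apply_self {N : ℕ} (q : Fin N) (p : PauliString N) : flip q p q = swapXY (p q) := by
  simp [flip]

lemma flip_apply_of_ne {N : ℕ} {q r : Fin N} (h : r ≠ q) (p : PauliString N) :
    flip q p r = p r := by
  simp [flip, h]

lemma swapXY_eq_zero_iff (i : Fin 4) : swapXY i = 0 ↔ i = 0 := by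
  fin_cases i <;> simp [swapXY]

lemma swapXY_eq_three_iff (i : Fin 4) : swapXY i = 3 ↔ i = 3 := by
  fin_cases i <;> simp [swapXY]

lemma mem_rows_congr {N : ℕ} {Q : Finset (Finset (Fin N))} {S : ℕ} {p r : PauliString N}
    (h0 : ∀ q, p q = 0 ↔ r q = 0) (h3 : ∀ q, p q = 3 ↔ r q = 3) :
    p ∈ rows Q S ↔ r ∈ rows Q S := by
  simp only [rows, supp, Finset.mem_filter, Finset.mem_univ, true_and, h0, h3, ne_eq]

lemma filter_eq_three_subset_supp {N : ℕ} (p : PauliString N) :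
    (Finset.univ.filter fun q => p q = 3) ⊆ supp p := by
  intro q hq
  simp only [supp, Finset.mem_filter, Finset.mem_univ, true_and] at hq ⊢
  simp [hq]

lemma flip_mem_rows {N : ℕ} {Q : Finset (Finset (Fin N))} {S : ℕ} (q : Fin N)
    (p : PauliString N) : flip q p ∈ rows Q S ↔ p ∈ rows Q S := by
  refine mem_rows_congr (fun r => ?_) fun r => ?_
  · by_cases h : r = q
    · subst h; rw [flip_apply_self, swapXY_eq_zero_iff]
    · rw [flip_apply_of_ne h]
  · by_cases h : r = q
    · subst h; rw [flip_apply_self, swapXY_eq_three_iff]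
    · rw [flip_apply_of_ne h]

/-- The change of basis `I, X, Y, Z ↦ I, (X + iY)/√2, (X - iY)/√2, Z`. -/
noncomputable def ladder : Fin 4 → Fin 4 → ℂ :=
  ![![1, 0, 0, 0], ![0, 1 / (√2 : ℝ), Complex.I / (√2 : ℝ), 0],
    ![0, 1 / (√2 : ℝ), -Complex.I / (√2 : ℝ), 0], ![0, 0, 0, 1]]

/-- The integer `γ` for which `iγ` is the eigenvalue of `(i/2) [·, Z]` on a ladder operator. -/
def ladderSign : Fin 4 → ℤ := ![0, -1, 1, 0]

lemma sqrt_two_mul_self : ((√2 : ℝ) : ℂ) * ((√2 : ℝ) : ℂ) = 2 := by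
  rw [← Complex.ofReal_mul, Real.mul_self_sqrt zero_le_two]; norm_num

lemma ladder_orthonormal (i j : Fin 4) :
    ∑ k, star (ladder k i) * ladder k j = if i = j then 1 else 0 := by
  have h := sqrt_two_mul_self
  have h0 : ((√2 : ℝ) : ℂ) ≠ 0 := by
    intro e; rw [e] at h; norm_num at h
  fin_cases i <;> fin_cases j <;>
    simp [Fin.sum_univ_four, ladder] <;> field_simp <;> ring_nf <;>
    simp [pow_two, h]

lemma ladder_swapXY (i k : Fin 4) :
    (signXY (swapXY k) : ℂ) * ladder i (swapXY k) =
      Complex.I * (ladderSign i : ℂ) * ladder i k := by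
  fin_cases i <;> fin_cases k <;> simp [signXY, swapXY, ladder, ladderSign] <;>
    ring_nf <;> simp [Complex.I_sq]

lemma ladder_ne_zero {i k : Fin 4} (h : ladder i k ≠ 0) :
    (i = 0 ↔ k = 0) ∧ (i = 3 ↔ k = 3) := by
  fin_cases i <;> fin_cases k <;> simp [ladder] at h ⊢

/-- The coefficients of a vector in the basis of tensor products of ladder operators. -/
noncomputable def ladderCoeff {N : ℕ} (u : PauliString N → ℝ) (p : PauliString N) : ℂ :=
  ∑ r, (∏ q, ladder (p q) (r q)) * (u r : ℂ)

lemma ladder_tensor_orthonormal {N : ℕ} (r s : PauliString N) :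
    ∑ p : PauliString N, star (∏ q, ladder (p q) (r q)) * ∏ q, ladder (p q) (s q) =
      if r = s then 1 else 0 := by
  simp only [star_prod, ← Finset.prod_mul_distrib]
  have h := Finset.prod_univ_sum (fun _ : Fin N => (Finset.univ : Finset (Fin 4)))
    (fun q k => star (ladder k (r q)) * ladder k (s q))
  rw [Fintype.piFinset_univ] at h
  rw [← h]
  simp only [ladder_orthonormal]
  split_ifs with e
  · subst e; simp
  · obtain ⟨q, hq⟩ := Function.ne_iff.mp e
    exact Finset.prod_eq_zero (Finset.mem_univ q) (by simp [hq])

/-- Parseval's identity for the ladder basis. -/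
lemma sum_normSq_ladderCoeff {N : ℕ} (u : PauliString N → ℝ) :
    ∑ p, Complex.normSq (ladderCoeff u p) = ∑ p, u p ^ 2 := by
  have h : ∀ p, ((Complex.normSq (ladderCoeff u p) : ℝ) : ℂ) =
      ∑ r, ∑ s, (u r : ℂ) * (u s : ℂ) *
        (star (∏ q, ladder (p q) (r q)) * ∏ q, ladder (p q) (s q)) := by
    intro p
    rw [Complex.normSq_eq_conj_mul_self, ladderCoeff, map_sum, Finset.sum_mul_sum]
    refine Finset.sum_congr rfl fun r _ => Finset.sum_congr rfl fun s _ => ?_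
    rw [map_mul, Complex.conj_ofReal]
    simp only [Complex.star_def]
    ring
  apply Complex.ofReal_injective
  push_cast
  simp only [h]
  rw [Finset.sum_comm]
  refine Finset.sum_congr rfl fun r _ => ?_
  rw [Finset.sum_comm]
  simp only [← Finset.mul_sum, ladder_tensor_orthonormal]
  simp [pow_two]

/-- Tensor products of ladder operators are eigenvectors of `derivOp`. -/
lemma ladderCoeff_derivOp {N : ℕ} (o : Fin N → ℝ) (u : PauliString N → ℝ) (p : PauliString N) :
    ladderCoeff (derivOp o u) p =
      Complex.I * ((∑ q, (ladderSign (p q) : ℝ) * o q : ℝ) : ℂ) * ladderCoeff u p := by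
  have key : ∀ q, ∑ r : PauliString N, (∏ q', ladder (p q') (r q')) *
      ((signXY (r q) : ℂ) * (u (flip q r) : ℂ)) =
        Complex.I * (ladderSign (p q) : ℂ) * ladderCoeff u p := by
    intro q
    rw [ladderCoeff, Finset.mul_sum]
    refine (Equiv.sum_comp (Function.Involutive.toPerm (flip q) (flip_flip q)) _).symm.trans
      (Finset.sum_congr rfl fun r _ => ?_)
    change (∏ q', ladder (p q') (flip q r q')) *
      ((signXY (flip q r q) : ℂ) * (u (flip q (flip q r)) : ℂ)) = _
    rw [flip_flip, flip_apply_self]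
    rw [← Finset.mul_prod_erase _ _ (Finset.mem_univ q),
      ← Finset.mul_prod_erase _ (fun q' => ladder (p q') (r q')) (Finset.mem_univ q)]
    have : ∏ x ∈ Finset.univ.erase q, ladder (p x) (flip q r x) =
        ∏ x ∈ Finset.univ.erase q, ladder (p x) (r x) :=
      Finset.prod_congr rfl fun x hx => by rw [flip_apply_of_ne (Finset.ne_of_mem_erase hx)]
    rw [this, flip_apply_self]
    linear_combination (∏ x ∈ Finset.univ.erase q, ladder (p x) (r x)) * (u r : ℂ) *
      ladder_swapXY (p q) (r q)
  rw [ladderCoeff]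
  simp only [derivOp]
  push_cast
  simp only [Finset.mul_sum]
  rw [Finset.sum_comm, Finset.sum_mul]
  refine Finset.sum_congr rfl fun q _ => ?_
  have := key q
  calc _ = (o q : ℂ) * ∑ r : PauliString N, (∏ q', ladder (p q') (r q')) *
      ((signXY (r q) : ℂ) * (u (flip q r) : ℂ)) := by
        rw [Finset.mul_sum]
        exact Finset.sum_congr rfl fun r _ => by ring
    _ = _ := by rw [this]; ring

/-- The change of basis preserves the positions of `I` and of `Z`, hence the rows. -/
lemma ladderCoeff_eq_zero {N : ℕ} {Q : Finset (Finset (Fin N))} {S : ℕ}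
    {u : PauliString N → ℝ} (hu : ∀ p, p ∉ rows Q S → u p = 0) {p : PauliString N}
    (hp : p ∉ rows Q S) : ladderCoeff u p = 0 := by
  refine Finset.sum_eq_zero fun r _ => ?_
  by_cases hr : r ∈ rows Q S
  · by_cases h : ∏ q, ladder (p q) (r q) = 0
    · rw [h, zero_mul]
    · rw [← ne_eq, Finset.prod_ne_zero_iff] at h
      exact absurd ((mem_rows_congr (fun q => (ladder_ne_zero (h q (Finset.mem_univ q))).1)
        fun q => (ladder_ne_zero (h q (Finset.mem_univ q))).2).2 hr) hp
  · simp [hu r hr]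

lemma abs_ladderSign_le_one (i : Fin 4) : |ladderSign i| ≤ 1 := by
  fin_cases i <;> simp [ladderSign]

lemma abs_ladderSign (i : Fin 4) : |ladderSign i| = if i ≠ 0 ∧ i ≠ 3 then 1 else 0 := by
  fin_cases i <;> simp [ladderSign]

lemma delta_le {N : ℕ} (o : Fin N → ℝ) {S : ℕ} (g : Fin N → ℤ) (h1 : ∀ q, |g q| ≤ 1)
    (h2 : 1 ≤ ∑ q, |g q|) (h3 : ∑ q, |g q| ≤ (S : ℤ)) :
    Delta o S ≤ (∑ q, (g q : ℝ) * o q) ^ 2 := by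
  refine csInf_le ⟨0, ?_⟩ ⟨g, h1, h2, h3, rfl⟩
  rintro x ⟨g, -, -, -, rfl⟩
  positivity

lemma sum_abs_ladderSign {N : ℕ} {Q : Finset (Finset (Fin N))} {S : ℕ}
    (hQ : ∀ s ∈ Q, s.card = S) {p : PauliString N} (hp : p ∈ rows Q S) :
    1 ≤ ∑ q, |ladderSign (p q)| ∧ ∑ q, |ladderSign (p q)| ≤ (S : ℤ) := by
  have hp' := (Finset.mem_filter.mp hp).2
  have e : ∑ q, |ladderSign (p q)| =
      (((supp p) \ (Finset.univ.filter fun q => p q = 3)).card : ℤ) := by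
    simp only [abs_ladderSign, Finset.sum_boole]
    congr 2
    ext q
    simp [supp]
  have hc := Finset.card_sdiff_add_card_eq_card (filter_eq_three_subset_supp p)
  rw [hQ _ hp'.1] at hc
  rw [e]
  have := hp'.2
  constructor <;> omega

/-- On the strings indexed by `rows Q S` the singular values of `derivOp` lie between `√Δ_S` and
`∑ |o_q|`. -/
lemma sum_derivOp_sq_bounds {N : ℕ} (o : Fin N → ℝ) {Q : Finset (Finset (Fin N))} {S : ℕ}
    (hQ : ∀ s ∈ Q, s.card = S) (u : PauliString N → ℝ) :
    Delta o S * ∑ p ∈ rows Q S, u p ^ 2 ≤ ∑ p ∈ rows Q S, derivOp o u p ^ 2 ∧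
    ∑ p ∈ rows Q S, derivOp o u p ^ 2 ≤ (∑ q, |o q|) ^ 2 * ∑ p ∈ rows Q S, u p ^ 2 := by
  classical
  -- `derivOp` preserves the rows, so the other entries of `u` may be set to zero
  set v : PauliString N → ℝ := fun p => if p ∈ rows Q S then u p else 0 with hv
  have hv0 : ∀ p, p ∉ rows Q S → v p = 0 := fun p hp => by simp [hv, hp]
  have hB : ∀ p, derivOp o v p = if p ∈ rows Q S then derivOp o u p else 0 := by
    intro p
    simp only [derivOp, hv, flip_mem_rows]
    split_ifs <;> simp
  have e1 : ∑ p ∈ rows Q S, u p ^ 2 = ∑ p, Complex.normSq (ladderCoeff v p) := by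
    rw [sum_normSq_ladderCoeff]
    simp only [hv, ite_pow, ne_eq, OfNat.ofNat_ne_zero, not_false_eq_true, zero_pow]
    rw [Finset.sum_ite_mem, Finset.univ_inter]
  have e2 : ∑ p ∈ rows Q S, derivOp o u p ^ 2 =
      ∑ p, (∑ q, (ladderSign (p q) : ℝ) * o q) ^ 2 * Complex.normSq (ladderCoeff v p) := by
    have h : ∑ p ∈ rows Q S, derivOp o u p ^ 2 = ∑ p, derivOp o v p ^ 2 := by
      simp only [hB, ite_pow, ne_eq, OfNat.ofNat_ne_zero, not_false_eq_true, zero_pow]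
      rw [Finset.sum_ite_mem, Finset.univ_inter]
    rw [h, ← sum_normSq_ladderCoeff]
    refine Finset.sum_congr rfl fun p _ => ?_
    rw [ladderCoeff_derivOp, Complex.normSq_mul, Complex.normSq_mul, Complex.normSq_I,
      Complex.normSq_ofReal]
    ring
  rw [e1, e2, Finset.mul_sum, Finset.mul_sum]
  constructor
  · refine Finset.sum_le_sum fun p _ => ?_
    by_cases hp : p ∈ rows Q S
    · obtain ⟨h1, h2⟩ := sum_abs_ladderSign hQ hp
      exact mul_le_mul_of_nonneg_right
        (delta_le o (fun q => ladderSign (p q)) (fun q => abs_ladderSign_le_one _) h1 h2)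
        (Complex.normSq_nonneg _)
    · simp [ladderCoeff_eq_zero hv0 hp]
  · refine Finset.sum_le_sum fun p _ => mul_le_mul_of_nonneg_right ?_ (Complex.normSq_nonneg _)
    rw [← sq_abs]
    gcongr
    refine (Finset.abs_sum_le_sum_abs _ _).trans (Finset.sum_le_sum fun q _ => ?_)
    rw [abs_mul]
    have : |(ladderSign (p q) : ℝ)| ≤ 1 := by exact_mod_cast abs_ladderSign_le_one (p q)
    nlinarith [abs_nonneg (o q)]

/-- A gate with `Z` on each of its qubits commutes with the observable. -/
lemma derivOp_eq_zero {N : ℕ} (o : Fin N → ℝ) (u : PauliString N → ℝ)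
    {Q : Finset (Finset (Fin N))} {S : ℕ} (hQ : ∀ s ∈ Q, s.card = S) {p : PauliString N}
    (hp : supp p ∈ Q) (hr : p ∉ rows Q S) : derivOp o u p = 0 := by
  have heq : (Finset.univ.filter fun q => p q = 3) = supp p := by
    refine Finset.eq_of_subset_of_card_le (filter_eq_three_subset_supp p) ?_
    rw [hQ _ hp]
    by_contra h
    exact hr (Finset.mem_filter.mpr ⟨Finset.mem_univ _, hp, not_le.mp h⟩)
  refine Finset.sum_eq_zero fun q _ => ?_
  have : p q = 0 ∨ p q = 3 := by
    by_cases h : p q = 0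
    · exact Or.inl h
    · right
      have : q ∈ supp p := by simp [supp, h]
      rw [← heq] at this
      simpa using this
  rcases this with h | h <;> simp [h, signXY]

/-- The norm of the observable is at least its eigenvalue `∑ |o_q|` on the computational basis
state that matches the signs of `o`. -/
lemma sum_abs_le_specNorm {N : ℕ} (o : Fin N → ℝ) :
    ∑ q, |o q| ≤ specNorm (observable o) := by
  classical
  let x : Fin N → Fin 2 := fun q => if 0 ≤ o q then 0 else 1
  have hZ : ∀ q y, pauliZ q y x = if y = x then (if 0 ≤ o q then 1 else -1) else 0 := by
    intro q y
    rw [pauliZ_eq_tensor, tensor_update_apply]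
    by_cases h : y = x
    · subst h
      rw [Finset.prod_eq_one (by simp)]
      by_cases h0 : 0 ≤ o q <;> simp [x, h0, pauli]
    · rw [if_neg h]
      obtain ⟨r, hr⟩ := Function.ne_iff.mp h
      by_cases hrq : r = q
      · subst hrq
        have : pauli 3 (y r) (x r) = 0 := by
          revert hr
          generalize y r = a
          generalize x r = b
          fin_cases a <;> fin_cases b <;> simp [pauli]
        rw [this, zero_mul]
      · rw [Finset.prod_eq_zero (Finset.mem_erase.mpr ⟨hrq, Finset.mem_univ r⟩)
          (by simp [hr]), mul_zero]
  have hO : ∀ y, observable o y x = if y = x then ((∑ q, |o q| : ℝ) : ℂ) else 0 := by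
    intro y
    simp only [observable, Matrix.sum_apply, Matrix.smul_apply, hZ, smul_eq_mul]
    by_cases h : y = x
    · simp only [h, if_true]
      push_cast
      refine Finset.sum_congr rfl fun q _ => ?_
      by_cases h0 : 0 ≤ o q
      · simp [h0, abs_of_nonneg h0]
      · simp [h0, abs_of_neg (not_le.mp h0)]
    · simp [h]
  let e : EuclideanSpace ℂ (Fin N → Fin 2) := EuclideanSpace.single x 1
  have h := (Matrix.toEuclideanCLM (n := Fin N → Fin 2) (𝕜 := ℂ) (observable o)).le_opNorm e
  have he : ‖e‖ = 1 := by simp [e]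
  rw [he, mul_one] at h
  refine le_trans ?_ h
  have hc := PiLp.norm_apply_le
    ((Matrix.toEuclideanCLM (n := Fin N → Fin 2) (𝕜 := ℂ) (observable o)) e) x
  refine le_trans ?_ hc
  have : ((Matrix.toEuclideanCLM (n := Fin N → Fin 2) (𝕜 := ℂ) (observable o)) e) x =
      ((∑ q, |o q| : ℝ) : ℂ) := by
    simp [e, hO]
  rw [this, Complex.norm_real]
  exact le_abs_self _

/-! ### Counting Pauli strings -/

lemma card_filter_supp_eq {N : ℕ} (s : Finset (Fin N)) :
    (Finset.univ.filter fun p : PauliString N => supp p = s).card = 3 ^ s.card := by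
  have h : (Finset.univ.filter fun p : PauliString N => supp p = s) =
      Fintype.piFinset fun q => if q ∈ s then ({1, 2, 3} : Finset (Fin 4)) else {0} := by
    ext p
    simp only [Finset.mem_filter, Finset.mem_univ, true_and, Fintype.mem_piFinset, supp,
      Finset.ext_iff]
    refine forall_congr' fun q => ?_
    by_cases hq : q ∈ s
    · simp only [hq, if_true, iff_true]
      generalize p q = i
      fin_cases i <;> simp
    · simp [hq]
  rw [h, Fintype.card_piFinset]
  have : ∀ q, (if q ∈ s then ({1, 2, 3} : Finset (Fin 4)) else {0}).card =
      if q ∈ s then 3 else 1 := fun q => by split_ifs <;> rfl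
  simp only [this]
  rw [Finset.prod_ite_mem, Finset.univ_inter, Finset.prod_const]

lemma card_filter_supp_mem {N : ℕ} {Q : Finset (Finset (Fin N))} {S : ℕ}
    (hQ : ∀ s ∈ Q, s.card = S) :
    (Finset.univ.filter fun p : PauliString N => supp p ∈ Q).card = 3 ^ S * Q.card := by
  rw [Finset.card_eq_sum_card_fiberwise (f := supp) (t := Q) fun p hp => by simpa using hp,
    Finset.sum_congr rfl (g := fun _ => 3 ^ S), Finset.sum_const, smul_eq_mul, mul_comm]
  intro s hs
  rw [← hQ s hs, ← card_filter_supp_eq s]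
  congr 1
  ext p
  simp only [Finset.mem_filter, Finset.mem_univ, true_and]
  exact ⟨fun h => h.2, fun h => ⟨h ▸ hs, h⟩⟩

/-- A string on a group of `Q` that is not a row consists of `Z` only, so there is one per group. -/
lemma card_filter_supp_mem_not_mem_rows {N : ℕ} {Q : Finset (Finset (Fin N))} {S : ℕ}
    (hQ : ∀ s ∈ Q, s.card = S) :
    (Finset.univ.filter fun p : PauliString N => supp p ∈ Q ∧ p ∉ rows Q S).card = Q.card := by
  refine Finset.card_nbij' (fun p => supp p) (fun s q => if q ∈ s then 3 else 0) ?_ ?_ ?_ ?_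
  · intro p hp
    simp only [Finset.coe_filter, Finset.mem_univ, true_and, Set.mem_ofPred_eq] at hp
    exact hp.1
  · intro s hs
    have h1 : supp (fun q => if q ∈ s then (3 : Fin 4) else 0) = s := by
      ext q; by_cases h : q ∈ s <;> simp [supp, h]
    have h2 : (Finset.univ.filter fun q => (if q ∈ s then (3 : Fin 4) else 0) = 3) = s := by
      ext q; by_cases h : q ∈ s <;> simp [h]
    simp only [Finset.coe_filter, Finset.mem_univ, true_and, Set.mem_ofPred_eq, rows,
      Finset.mem_filter, h1, h2, not_and, not_lt]
    exact ⟨hs, fun _ => (hQ s hs).ge⟩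
  · intro p hp
    simp only [Finset.coe_filter, Finset.mem_univ, true_and, Set.mem_ofPred_eq, rows,
      Finset.mem_filter, not_and, not_lt] at hp
    have heq := Finset.eq_of_subset_of_card_le (filter_eq_three_subset_supp p)
      (by rw [hQ _ hp.1]; exact hp.2 hp.1)
    funext q
    by_cases h : q ∈ supp p
    · simp only [h, if_true]
      rw [← heq] at h
      exact (Finset.mem_filter.mp h).2.symm
    · simp only [h, if_false]
      simpa [supp] using Eq.symm (by simpa [supp] using h : p q = 0)
  · intro s hs
    ext q; by_cases h : q ∈ s <;> simp [supp, h]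

lemma card_rows {N : ℕ} {Q : Finset (Finset (Fin N))} {S : ℕ}
    (hQ : ∀ s ∈ Q, s.card = S) : (rows Q S).card + Q.card = 3 ^ S * Q.card := by
  rw [← card_filter_supp_mem hQ, ← card_filter_supp_mem_not_mem_rows hQ]
  rw [← Finset.card_filter_add_card_filter_not (s := Finset.univ.filter
    fun p : PauliString N => supp p ∈ Q) (fun p => p ∈ rows Q S), Finset.filter_filter,
    Finset.filter_filter]
  congr 2
  ext p
  simp only [Finset.mem_filter, Finset.mem_univ, true_and]
  exact ⟨fun h => ⟨(Finset.mem_filter.mp h).2.1, h⟩, fun h => h.2⟩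

lemma card_rows_real {N : ℕ} {Q : Finset (Finset (Fin N))} {S : ℕ}
    (hQ : ∀ s ∈ Q, s.card = S) : ((rows Q S).card : ℝ) = ((3 : ℝ) ^ S - 1) * Q.card := by
  have := card_rows hQ
  have h : ((rows Q S).card : ℝ) + Q.card = 3 ^ S * Q.card := by exact_mod_cast this
  linarith

lemma rows_nonempty {N : ℕ} {Q : Finset (Finset (Fin N))} {S : ℕ} (hS : 1 ≤ S)
    (hQ : ∀ s ∈ Q, s.card = S) (hne : Q.Nonempty) : (rows Q S).Nonempty := by
  rw [← Finset.card_pos]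
  have := card_rows hQ
  have h3 : 3 ^ 1 ≤ 3 ^ S := Nat.pow_le_pow_right (by norm_num) hS
  have := hne.card_pos
  nlinarith

lemma card_le_choose {N : ℕ} {Q : Finset (Finset (Fin N))} {S : ℕ}
    (hQ : ∀ s ∈ Q, s.card = S) : Q.card ≤ N.choose S := by
  have : Q ⊆ Finset.powersetCard S Finset.univ := fun s hs =>
    Finset.mem_powersetCard.mpr ⟨Finset.subset_univ s, hQ s hs⟩
  simpa using Finset.card_le_card this

/-! ### Pigeonhole bounds on the observable -/

lemma card_mul_sqrt_delta_le {N : ℕ} (o : Fin N → ℝ) {S : ℕ} (hS : 1 ≤ S) :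
    N * √(Delta o S) ≤ ∑ q, |o q| := by
  have h : ∀ q, √(Delta o S) ≤ |o q| := by
    intro q
    refine Real.sqrt_le_iff.mpr ⟨abs_nonneg _, ?_⟩
    have := delta_le o (S := S) (Pi.single q 1) (fun r => ?_) ?_ ?_
    · refine this.trans_eq ?_
      rw [sq_abs, Finset.sum_eq_single q] <;> simp +contextual
    · by_cases hr : r = q <;> simp [hr]
    all_goals
      rw [Finset.sum_eq_single q] <;> simp +contextual
    exact hS
  calc N * √(Delta o S) = ∑ _q : Fin N, √(Delta o S) := by simp
    _ ≤ _ := Finset.sum_le_sum fun q _ => h q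

/-- Sums of `|o_q|` over different sets of at most `S / 2` qubits differ by at least `√Δ_S`. -/
lemma sqrt_delta_le_abs_sub {N : ℕ} (o : Fin N → ℝ) {S m : ℕ} (hm : 2 * m ≤ S)
    {T T' : Finset (Fin N)} (hT : T.card = m) (hT' : T'.card = m) (hne : T ≠ T') :
    √(Delta o S) ≤ |(∑ q ∈ T, |o q|) - (∑ q ∈ T', |o q|)| := by
  classical
  -- the difference of the two sums is `g · o` with `g` the signed symmetric difference `sg * e`
  let e : Fin N → ℤ := fun q => (if q ∈ T then 1 else 0) - (if q ∈ T' then 1 else 0)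
  let sg : Fin N → ℤ := fun q => if 0 ≤ o q then 1 else -1
  have hsg : ∀ q, |sg q| = 1 := fun q => by by_cases h : 0 ≤ o q <;> simp [sg, h]
  have he : ∀ q, |sg q * e q| = |e q| := fun q => by rw [abs_mul, hsg, one_mul]
  have he1 : ∀ q, |e q| ≤ 1 := fun q => by
    by_cases h : q ∈ T <;> by_cases h' : q ∈ T' <;> simp [e, h, h']
  refine Real.sqrt_le_iff.mpr ⟨abs_nonneg _, ?_⟩
  have := delta_le o (S := S) (fun q => sg q * e q) (fun q => (he q).trans_le (he1 q)) ?_ ?_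
  · refine this.trans_eq ?_
    rw [sq_abs]
    congr 1
    have hT1 : ∑ q ∈ T, |o q| = ∑ q, if q ∈ T then |o q| else 0 := by
      rw [Finset.sum_ite_mem, Finset.univ_inter]
    have hT2 : ∑ q ∈ T', |o q| = ∑ q, if q ∈ T' then |o q| else 0 := by
      rw [Finset.sum_ite_mem, Finset.univ_inter]
    rw [hT1, hT2, ← Finset.sum_sub_distrib]
    refine Finset.sum_congr rfl fun q _ => ?_
    have ho : ((sg q : ℤ) : ℝ) * o q = |o q| := by
      by_cases h : 0 ≤ o q
      · simp [sg, h, abs_of_nonneg h]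
      · simp [sg, h, abs_of_neg (not_le.mp h)]
    push_cast
    rw [mul_right_comm, ho]
    by_cases h : q ∈ T <;> by_cases h' : q ∈ T' <;> simp [e, h, h']
  · simp only [he]
    obtain ⟨q, hq⟩ : ∃ q, e q ≠ 0 := by
      by_contra! h
      refine hne (Finset.ext fun q => ?_)
      have := h q
      by_cases h1 : q ∈ T <;> by_cases h2 : q ∈ T' <;> simp [e, h1, h2] at this ⊢
    exact (Int.one_le_abs hq).trans
      (Finset.single_le_sum (f := fun q => |e q|) (fun q _ => abs_nonneg _) (Finset.mem_univ q))
  · simp only [he]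
    calc ∑ q, |e q| ≤ ∑ q, ((if q ∈ T then 1 else 0) + if q ∈ T' then 1 else 0 : ℤ) :=
          Finset.sum_le_sum fun q _ => by
            by_cases h : q ∈ T <;> by_cases h' : q ∈ T' <;> simp [e, h, h']
      _ = T.card + T'.card := by
          rw [Finset.sum_add_distrib]; simp [Finset.sum_ite_mem]
      _ ≤ S := by rw [hT, hT']; exact_mod_cast (by omega : m + m ≤ S)

lemma sum_powersetCard_sum {N : ℕ} (f : Fin N → ℝ) (m : ℕ) :
    ∑ T ∈ Finset.powersetCard (m + 1) (Finset.univ : Finset (Fin N)), ∑ q ∈ T, f q =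
      ((N - 1).choose m : ℝ) * ∑ q, f q := by
  classical
  have h : ∀ T : Finset (Fin N), ∑ q ∈ T, f q = ∑ q, if {q} ⊆ T then f q else 0 := fun T => by
    simp only [Finset.singleton_subset_iff, Finset.sum_ite_mem, Finset.univ_inter]
  simp only [h]
  rw [Finset.sum_comm, Finset.mul_sum]
  refine Finset.sum_congr rfl fun q _ => ?_
  rw [← Finset.sum_filter, Finset.sum_const,
    Finset.card_filter_powersetCard_subset _ _ _ (Finset.subset_univ _) (by simp)]
  simp

/-- A sum of `L` nonnegative numbers with pairwise distances at least `c` is at least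
`c (0 + 1 + ⋯ + (L - 1))`. -/
lemma choose_two_mul_le_sum_of_separated {ι : Type*} (F : Finset ι) (x : ι → ℝ) {c : ℝ}
    (hc : 0 < c) (h0 : ∀ i ∈ F, 0 ≤ x i)
    (hsep : ∀ i ∈ F, ∀ j ∈ F, i ≠ j → c ≤ |x i - x j|) :
    c * ((F.card : ℝ) * (F.card - 1) / 2) ≤ ∑ i ∈ F, x i := by
  classical
  -- the integers `⌊x i / c⌋` are distinct and nonnegative
  have hinj : Set.InjOn (fun i => ⌊x i / c⌋) F := by
    intro i hi j hj hij
    by_contra hne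
    have h1 := Int.abs_sub_lt_one_of_floor_eq_floor hij
    have h2 := hsep i hi j hj hne
    rw [← sub_div, abs_div, abs_of_pos hc, div_lt_one hc] at h1
    linarith
  have h := Finset.sum_range_le_sum (s := F.image fun i => ⌊x i / c⌋) (c := 0) (by
    intro z hz
    obtain ⟨i, hi, rfl⟩ := Finset.mem_image.mp hz
    exact Int.floor_nonneg.mpr (div_nonneg (h0 i hi) hc.le))
  rw [Finset.card_image_of_injOn hinj, Finset.sum_image hinj] at h
  simp only [zero_add] at h
  have h2 : (∑ n ∈ Finset.range F.card, (n : ℝ)) ≤ ∑ i ∈ F, (⌊x i / c⌋ : ℝ) := by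
    have := (Int.cast_le (R := ℝ)).mpr h
    push_cast at this
    exact this
  have h3 : (∑ n ∈ Finset.range F.card, (n : ℝ)) = (F.card : ℝ) * (F.card - 1) / 2 := by
    induction F.card with
    | zero => simp
    | succ k ih => rw [Finset.sum_range_succ, ih]; push_cast; ring
  have h4 : ∑ i ∈ F, (⌊x i / c⌋ : ℝ) ≤ (∑ i ∈ F, x i) / c := by
    rw [Finset.sum_div]
    exact Finset.sum_le_sum fun i _ => Int.floor_le _
  rw [h3] at h2
  have := h2.trans h4
  rwa [le_div_iff₀ hc, mul_comm] at this

lemma choose_sub_mul_le {N S : ℕ} (hS : 2 ≤ S) :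
    (N - S / 2).choose (S - S / 2) * (S / 2) ≤ N.choose (S / 2) * N := by
  set m := S / 2 with hm
  have h1 : (N - m).choose m ≤ N.choose m := Nat.choose_le_choose _ (Nat.sub_le _ _)
  rcases Nat.even_or_odd' S with ⟨t, ht | ht⟩
  · have : S - m = m := by omega
    rw [this]
    by_cases hN : m ≤ N
    · exact Nat.mul_le_mul h1 hN
    · rw [Nat.choose_eq_zero_of_lt (by omega : N - m < m)]; simp
  · have : S - m = m + 1 := by omega
    rw [this]
    calc _ ≤ (N - m).choose (m + 1) * (m + 1) := Nat.mul_le_mul_left _ (Nat.le_succ m)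
      _ = (N - m).choose m * (N - m - m) := Nat.choose_succ_right_eq _ _
      _ ≤ _ := Nat.mul_le_mul h1 (by omega)

/-- A lower bound on `∑ |o_q| / √Δ_S`, obtained by averaging over all sets of `S / 2` qubits the
sums of `|o_q|`, which are nonnegative and `√Δ_S`-separated. -/
lemma choose_mul_choose_le {N S : ℕ} (o : Fin N → ℝ) (hS : 2 ≤ S) (hSN : S ≤ N)
    (hΔ : 0 < Delta o S) :
    (N.choose S : ℝ) * S.choose (S / 2) ≤ 8 * ((∑ q, |o q|) / √(Delta o S)) ^ 2 := by
  set W := (∑ q, |o q|) / √(Delta o S) with hW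
  set m := S / 2 with hm
  have hm1 : 1 ≤ m := by omega
  have hsq : 0 < √(Delta o S) := Real.sqrt_pos.mpr hΔ
  have hW0 : 0 ≤ W := div_nonneg (Finset.sum_nonneg fun _ _ => abs_nonneg _) hsq.le
  set L := N.choose m with hL
  -- the average of the sums over `m`-element sets is `m / N` times the full sum
  have key : √(Delta o S) * ((L : ℝ) * (L - 1) / 2) ≤
      ((N - 1).choose (m - 1) : ℝ) * ∑ q, |o q| := by
    have h := choose_two_mul_le_sum_of_separated
      (Finset.powersetCard m (Finset.univ : Finset (Fin N))) (fun T => ∑ q ∈ T, |o q|) hsq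
      (fun T _ => Finset.sum_nonneg fun _ _ => abs_nonneg _)
      (fun T hT T' hT' hne => sqrt_delta_le_abs_sub o (by omega : 2 * m ≤ S)
        (Finset.mem_powersetCard.mp hT).2 (Finset.mem_powersetCard.mp hT').2 hne)
    rw [Finset.card_powersetCard, Finset.card_univ, Fintype.card_fin] at h
    refine h.trans_eq ?_
    have := sum_powersetCard_sum (fun q => |o q|) (m - 1) (N := N)
    rwa [Nat.sub_add_cancel hm1] at this
  have hsum : ∑ q, |o q| = √(Delta o S) * W := by rw [hW]; field_simp
  rw [hsum, mul_left_comm] at key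
  have key' : (L : ℝ) * (L - 1) / 2 ≤ ((N - 1).choose (m - 1) : ℝ) * W :=
    le_of_mul_le_mul_left key hsq
  have hpas : (N : ℝ) * (N - 1).choose (m - 1) = L * m := by
    have := Nat.add_one_mul_choose_eq (N - 1) (m - 1)
    rw [Nat.sub_add_cancel (by omega : 1 ≤ N), Nat.sub_add_cancel hm1] at this
    exact_mod_cast this
  have hL2 : (2 : ℝ) ≤ L := by
    have h1 : N ≤ L := by
      have : N.choose 1 ≤ N.choose m := by
        have hle : ∀ j, 1 ≤ j → j ≤ N / 2 → N.choose 1 ≤ N.choose j := by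
          intro j hj
          induction j, hj using Nat.le_induction with
          | base => exact fun _ => le_rfl
          | succ j _ ih =>
            exact fun h => (ih (by omega)).trans (Nat.choose_le_succ_of_lt_half_left (by omega))
        exact hle m hm1 (by omega)
      simpa using this
    exact_mod_cast (by omega : 2 ≤ L)
  have hmpos : (0 : ℝ) < m := by exact_mod_cast hm1
  have hNpos : (0 : ℝ) < N := by exact_mod_cast (by omega : 0 < N)
  have h1 : (N : ℝ) * L ≤ 4 * m * W := by
    have h2 : (N : ℝ) * (L * (L - 1) / 2) ≤ L * m * W := by
      rw [← hpas, mul_assoc]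
      exact mul_le_mul_of_nonneg_left key' hNpos.le
    have h3 : (L : ℝ) * (N * (L - 1)) ≤ L * (2 * m * W) := by linarith
    have h4 := le_of_mul_le_mul_left h3 (by linarith)
    nlinarith
  have hch : (N.choose S : ℝ) * S.choose m = L * (N - m).choose (S - m) := by
    exact_mod_cast Nat.choose_mul (by omega : m ≤ S)
  have h5 : ((N - m).choose (S - m) : ℝ) * m ≤ L * N := by
    exact_mod_cast choose_sub_mul_le hS
  rw [hch]
  have h6 : ((N : ℝ) * L) ^ 2 ≤ (4 * m * W) ^ 2 := by
    have : (0 : ℝ) ≤ N * L := by positivity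
    gcongr
  have hm2 : (2 : ℝ) * m ≤ N := by exact_mod_cast (by omega : 2 * m ≤ N)
  have h7 : (N * m : ℝ) * (L * (N - m).choose (S - m)) ≤ (N * m) * (8 * W ^ 2) := by
    calc (N * m : ℝ) * (L * (N - m).choose (S - m))
        = (N * L) * ((N - m).choose (S - m) * m) := by ring
      _ ≤ (N * L) * (L * N) := by gcongr
      _ = (N * L) ^ 2 := by ring
      _ ≤ (4 * m * W) ^ 2 := h6
      _ = (2 * m) * m * (8 * W ^ 2) := by ring
      _ ≤ _ := by gcongr
  exact le_of_mul_le_mul_left h7 (by positivity)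

/-- The number `3 ^ S |Q|` of possible gates is small compared with the fourth power of
`∑ |o_q| / √Δ_S`, with room to spare in the exponent. -/
lemma card_pow_le {N S : ℕ} (o : Fin N → ℝ) {Q : Finset (Finset (Fin N))} (hS : 1 ≤ S)
    (hQ : ∀ s ∈ Q, s.card = S) (hne : Q.Nonempty) (hΔ : 0 < Delta o S) :
    ((3 : ℝ) ^ S * Q.card) ^ 9 ≤ 160 ^ 16 * ((∑ q, |o q|) / √(Delta o S)) ^ 32 := by
  set W := (∑ q, |o q|) / √(Delta o S) with hW
  have hsq : 0 < √(Delta o S) := Real.sqrt_pos.mpr hΔ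
  have hSN : S ≤ N := by
    obtain ⟨s, hs⟩ := hne
    rw [← hQ s hs]
    simpa using Finset.card_le_univ s
  have hWN : (N : ℝ) ≤ W := by
    rw [hW, le_div_iff₀ hsq]; exact card_mul_sqrt_delta_le o hS
  have hN1 : (1 : ℝ) ≤ N := by exact_mod_cast hS.trans hSN
  have hQc : (Q.card : ℝ) ≤ N.choose S := by exact_mod_cast card_le_choose hQ
  have hCpos : (1 : ℝ) ≤ N.choose S := by exact_mod_cast Nat.choose_pos hSN
  rcases Nat.lt_or_ge 1 S with hS2 | hS1
  · have h1 := choose_mul_choose_le o hS2 hSN hΔ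
    have h2 : (2 : ℝ) ^ S ≤ (S + 1) * S.choose (S / 2) := by
      have := Nat.sum_range_choose S
      have hle : ∑ i ∈ Finset.range (S + 1), S.choose i ≤
          ∑ _i ∈ Finset.range (S + 1), S.choose (S / 2) :=
        Finset.sum_le_sum fun i _ => Nat.choose_le_middle i S
      rw [this, Finset.sum_const, Finset.card_range, smul_eq_mul] at hle
      exact_mod_cast hle
    -- Bernoulli's inequality absorbs the factor `S + 1`
    have h3 : (S + 1 : ℝ) ≤ 20 * (21 / 20) ^ S := by
      have := one_add_mul_le_pow (by norm_num : (-2 : ℝ) ≤ 1 / 20) S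
      norm_num at this ⊢
      linarith
    have h4 : (N.choose S : ℝ) * (40 / 21) ^ S ≤ 160 * W ^ 2 := by
      have h5 : (N.choose S : ℝ) * 2 ^ S ≤ 20 * (21 / 20) ^ S * (8 * W ^ 2) := by
        calc (N.choose S : ℝ) * 2 ^ S ≤ N.choose S * ((S + 1) * S.choose (S / 2)) := by gcongr
          _ = (S + 1) * (N.choose S * S.choose (S / 2)) := by ring
          _ ≤ _ := by gcongr
      have h6 : (2 : ℝ) ^ S = (21 / 20) ^ S * (40 / 21) ^ S := by
        rw [← mul_pow]; norm_num
      rw [h6] at h5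
      have h7 : (0 : ℝ) < (21 / 20) ^ S := by positivity
      refine le_of_mul_le_mul_left ?_ h7
      linarith
    have hfin : (3 : ℝ) ^ 9 ≤ (40 / 21) ^ 16 := by norm_num
    calc ((3 : ℝ) ^ S * Q.card) ^ 9 ≤ (3 ^ S * N.choose S) ^ 9 := by gcongr
      _ = (3 ^ 9) ^ S * (N.choose S : ℝ) ^ 9 := by rw [mul_pow, pow_right_comm]
      _ ≤ ((40 / 21) ^ 16) ^ S * (N.choose S : ℝ) ^ 16 := by
          gcongr ?_ * ?_
          · exact pow_le_pow_left₀ (by positivity) hfin S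
          · exact pow_le_pow_right₀ hCpos (by norm_num)
      _ = (N.choose S * (40 / 21) ^ S) ^ 16 := by rw [mul_pow, pow_right_comm, mul_comm]
      _ ≤ (160 * W ^ 2) ^ 16 := by gcongr
      _ = _ := by ring
  · obtain rfl : S = 1 := le_antisymm hS1 hS
    rw [Nat.choose_one_right] at hQc
    have hW1 : 1 ≤ W := hN1.trans hWN
    calc ((3 : ℝ) ^ 1 * Q.card) ^ 9 ≤ (3 * W) ^ 9 := by
          rw [pow_one]; have := hQc.trans hWN; gcongr
      _ = 3 ^ 9 * W ^ 9 := by ring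
      _ ≤ 160 ^ 16 * W ^ 32 := by
          gcongr
          · norm_num
          · norm_num

/-! ### Concentration of the gate counts -/

section Counts

variable {Ω : Type*} [MeasurableSpace Ω] {μ : Measure Ω} [IsProbabilityMeasure μ]

lemma mgf_indicator_le {A : Set Ω} (hA : MeasurableSet A) (t : ℝ) :
    mgf (A.indicator fun _ => (1 : ℝ)) μ t ≤ Real.exp (μ.real A * (Real.exp t - 1)) := by
  have h : ∀ ω, Real.exp (t * A.indicator (fun _ => (1 : ℝ)) ω) =
      1 + A.indicator (fun _ => (1 : ℝ)) ω * (Real.exp t - 1) := by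
    intro ω
    by_cases hω : ω ∈ A <;> simp [hω]
  have hi : Integrable (A.indicator fun _ => (1 : ℝ)) μ := (integrable_const _).indicator hA
  rw [mgf]
  simp only [h]
  rw [integral_add (integrable_const _) (hi.mul_const _), integral_mul_const,
    integral_indicator_const _ hA]
  simp only [integral_const, probReal_univ, smul_eq_mul, mul_one]
  linarith [Real.add_one_le_exp (μ.real A * (Real.exp t - 1))]

/-- A Chernoff bound for the number of events that occur in an independent family. -/
lemma chernoff_indicator {ι : Type*} [Fintype ι] {A : ι → Set Ω} (hA : ∀ i, MeasurableSet (A i))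
    (hind : iIndepFun (fun i => (A i).indicator fun _ => (1 : ℝ)) μ) {m η : ℝ}
    (hm : ∑ i, μ.real (A i) = m) (h0 : 0 < η) (h1 : η < 1) :
    μ.real {ω | η * m ≤ |(∑ i, (A i).indicator (fun _ => (1 : ℝ)) ω) - m|} ≤
      2 * Real.exp (-(m * η ^ 2 / 4)) := by
  set X : ι → Ω → ℝ := fun i => (A i).indicator fun _ => (1 : ℝ) with hX
  have hXm : ∀ i, Measurable (X i) := fun i => measurable_const.indicator (hA i)
  have hm0 : 0 ≤ m := hm ▸ Finset.sum_nonneg fun _ _ => measureReal_nonneg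
  have hmgf : ∀ t : ℝ, |t| ≤ 1 → mgf (∑ i, X i) μ t ≤ Real.exp (m * (t + t ^ 2)) := by
    intro t ht
    rw [hind.mgf_sum hXm]
    calc ∏ i, mgf (X i) μ t ≤ ∏ i, Real.exp (μ.real (A i) * (Real.exp t - 1)) :=
          Finset.prod_le_prod (fun i _ => mgf_nonneg) fun i _ => mgf_indicator_le (hA i) t
      _ = Real.exp (m * (Real.exp t - 1)) := by
          rw [← Real.exp_sum, ← Finset.sum_mul, hm]
      _ ≤ _ := by
          have := (abs_le.mp (Real.abs_exp_sub_one_sub_id_le ht)).2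
          gcongr
          linarith
  have hint : ∀ t : ℝ, Integrable (fun ω => Real.exp (t * (∑ i, X i) ω)) μ := by
    intro t
    have hmeas : Measurable (∑ i, X i) := by
      rw [Finset.sum_fn]
      exact Finset.measurable_sum _ fun i _ => hXm i
    refine Integrable.of_bound (C := Real.exp (|t| * Fintype.card ι))
      (by fun_prop) (ae_of_all _ fun ω => ?_)
    rw [Real.norm_eq_abs, Real.abs_exp, Real.exp_le_exp]
    have hs0 : 0 ≤ (∑ i, X i) ω := by
      rw [Finset.sum_apply]
      exact Finset.sum_nonneg fun i _ => Set.indicator_nonneg (fun _ _ => zero_le_one) ω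
    have hs : (∑ i, X i) ω ≤ Fintype.card ι := by
      rw [Finset.sum_apply]
      calc ∑ i, X i ω ≤ ∑ _i : ι, (1 : ℝ) :=
            Finset.sum_le_sum fun i _ => Set.indicator_le_self' (fun _ _ => zero_le_one) ω
        _ = _ := by simp
    exact mul_le_mul (le_abs_self t) hs hs0 (abs_nonneg t)
  -- Markov's inequality at `t = ± η / 2`, where the exponent `t² ∓ t η` is minimal
  have hup := measure_ge_le_exp_mul_mgf (μ := μ) (X := ∑ i, X i) ((1 + η) * m)
    (by linarith : 0 ≤ η / 2) (hint _)
  have hlo := measure_le_le_exp_mul_mgf (μ := μ) (X := ∑ i, X i) ((1 - η) * m)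
    (by linarith : -(η / 2) ≤ 0) (hint _)
  have hup' := hup.trans (mul_le_mul_of_nonneg_left
    (hmgf (η / 2) (by rw [abs_le]; constructor <;> linarith)) (Real.exp_nonneg _))
  have hlo' := hlo.trans (mul_le_mul_of_nonneg_left
    (hmgf (-(η / 2)) (by rw [abs_le]; constructor <;> linarith)) (Real.exp_nonneg _))
  rw [← Real.exp_add] at hup' hlo'
  have e1 : -(η / 2) * ((1 + η) * m) + m * (η / 2 + (η / 2) ^ 2) = -(m * η ^ 2 / 4) := by ring
  have e2 : -(-(η / 2)) * ((1 - η) * m) + m * (-(η / 2) + (-(η / 2)) ^ 2) =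
      -(m * η ^ 2 / 4) := by ring
  rw [e1] at hup'
  rw [e2] at hlo'
  have hsub : {ω | η * m ≤ |(∑ i, X i ω) - m|} ⊆
      {ω | (1 + η) * m ≤ (∑ i, X i) ω} ∪ {ω | (∑ i, X i) ω ≤ (1 - η) * m} := by
    intro ω hω
    simp only [Set.mem_union, Set.mem_ofPred_eq, Finset.sum_apply] at hω ⊢
    rcases le_abs.mp hω with h | h
    · left; linarith
    · right; linarith
  calc _ ≤ _ := measureReal_mono hsub
    _ ≤ _ := measureReal_union_le _ _
    _ ≤ _ := by linarith

/-- With high probability every gate occurs about equally often. -/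
lemma measure_exists_count_deviation_le {N S D : ℕ} {Q : Finset (Finset (Fin N))}
    {P : Fin D → Ω → PauliString N} (hP : IsRandomCircuit μ Q S P)
    (hQ : ∀ s ∈ Q, s.card = S) {η : ℝ} (h0 : 0 < η) (h1 : η < 1) :
    μ.real {ω | ∃ p, supp p ∈ Q ∧ η * (D / (3 ^ S * Q.card)) ≤
      |((Finset.univ.filter fun d => P d ω = p).card : ℝ) - D / (3 ^ S * Q.card)|} ≤
      (3 ^ S * Q.card) * (2 * Real.exp (-(D / (3 ^ S * Q.card) * η ^ 2 / 4))) := by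
  set m : ℝ := D / (3 ^ S * Q.card) with hm
  have hp : ∀ p, supp p ∈ Q → μ.real {ω | η * m ≤
      |((Finset.univ.filter fun d => P d ω = p).card : ℝ) - m|} ≤
        2 * Real.exp (-(m * η ^ 2 / 4)) := by
    intro p hpQ
    have hA : ∀ d, MeasurableSet {ω | P d ω = p} := fun d =>
      hP.measurable d (measurableSet_singleton p)
    have hind : iIndepFun (fun d => ({ω | P d ω = p}).indicator fun _ => (1 : ℝ)) μ :=
      hP.indep.comp (fun _ => ({p} : Set (PauliString N)).indicator fun _ => (1 : ℝ))
        fun _ => measurable_const.indicator (measurableSet_singleton p)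
    have hsum : ∑ d, μ.real {ω | P d ω = p} = m := by
      simp only [hP.hamiltonian _ p hpQ]
      rw [← Finset.sum_div, hP.groups _ hpQ, div_div, hm, mul_comm (Q.card : ℝ)]
    have h := chernoff_indicator hA hind hsum h0 h1
    refine le_trans (le_of_eq ?_) h
    congr 1
    ext ω
    simp only [Set.mem_ofPred_eq]
    have : ((Finset.univ.filter fun d => P d ω = p).card : ℝ) =
        ∑ d, ({ω | P d ω = p}).indicator (fun _ => (1 : ℝ)) ω := by
      rw [Finset.card_filter]
      push_cast
      exact Finset.sum_congr rfl fun d _ => by by_cases h : P d ω = p <;> simp [h]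
    rw [this]
  have hsub : {ω | ∃ p, supp p ∈ Q ∧ η * m ≤
      |((Finset.univ.filter fun d => P d ω = p).card : ℝ) - m|} ⊆
      ⋃ p ∈ Finset.univ.filter (fun p : PauliString N => supp p ∈ Q),
        {ω | η * m ≤ |((Finset.univ.filter fun d => P d ω = p).card : ℝ) - m|} := by
    rintro ω ⟨p, h1, h2⟩
    simp only [Set.mem_iUnion]
    exact ⟨p, by simpa using h1, h2⟩
  calc _ ≤ _ := measureReal_mono hsub (measure_ne_top μ _)
    _ ≤ _ := measureReal_biUnion_finset_le _ _
    _ ≤ ∑ _p ∈ Finset.univ.filter (fun p : PauliString N => supp p ∈ Q),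
        2 * Real.exp (-(m * η ^ 2 / 4)) :=
      Finset.sum_le_sum fun p hpp => hp p (by simpa using hpp)
    _ = _ := by
      rw [Finset.sum_const, card_filter_supp_mem hQ, nsmul_eq_mul]
      push_cast
      ring

end Counts

/-! ### Second moments of the Pauli coefficients -/

section Ensemble

variable {Ω : Type*} [MeasurableSpace Ω] {μ : Measure Ω}
  {N n S : ℕ} {Q : Finset (Finset (Fin N))} {α : PauliString N → ℝ} {ρ : Fin n → Ω → QMat N}

lemma ne_zero_of_mem_rows (hS : 1 ≤ S) (hQ : ∀ s ∈ Q, s.card = S) {p : PauliString N}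
    (hp : p ∈ rows Q S) : p ≠ 0 := by
  rintro rfl
  have := hQ _ (Finset.mem_filter.mp hp).2.1
  simp [supp] at this
  omega

lemma measurable_pauliCoeff (p : PauliString N) :
    Measurable fun M : (Fin N → Fin 2) → (Fin N → Fin 2) → ℂ => pauliCoeff (Matrix.of M) p := by
  simp only [pauliCoeff, Matrix.trace, Matrix.diag_apply, Matrix.mul_apply, Matrix.of_apply]
  fun_prop

lemma measurable_entries (h : IsUncorrelatedEnsemble μ ρ α) (a : Fin n) :
    Measurable fun ω => fun x y => ρ a ω x y :=
  measurable_pi_lambda _ fun x => measurable_pi_lambda _ fun y => h.measurable a x y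

lemma measurable_pauliCoeff_state (h : IsUncorrelatedEnsemble μ ρ α) (a : Fin n)
    (p : PauliString N) : Measurable fun ω => pauliCoeff (ρ a ω) p :=
  (measurable_pauliCoeff p).comp (measurable_entries h a)

lemma integrable_pauliCoeff_sq (h : IsUncorrelatedEnsemble μ ρ α) (a : Fin n)
    {p : PauliString N} (hp : p ≠ 0) (hα : 0 < α p) :
    Integrable (fun ω => pauliCoeff (ρ a ω) p ^ 2) μ := by
  -- a nonzero Bochner integral can only be that of an integrable function
  by_contra hc
  have h1 := h.cov a a p p hp hp
  simp only [← pow_two, and_self, if_true] at h1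
  rw [integral_undef hc] at h1
  exact hα.ne h1

lemma integrable_pauliCoeff_mul (h : IsUncorrelatedEnsemble μ ρ α) (a : Fin n)
    {p q : PauliString N} (hp : p ≠ 0) (hq : q ≠ 0) (hαp : 0 < α p) (hαq : 0 < α q) :
    Integrable (fun ω => pauliCoeff (ρ a ω) p * pauliCoeff (ρ a ω) q) μ :=
  MemLp.integrable_mul
    ((memLp_two_iff_integrable_sq (measurable_pauliCoeff_state h a p).aestronglyMeasurable).2
      (integrable_pauliCoeff_sq h a hp hαp))
    ((memLp_two_iff_integrable_sq (measurable_pauliCoeff_state h a q).aestronglyMeasurable).2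
      (integrable_pauliCoeff_sq h a hq hαq))

/-- Entries of the Gram matrix of the columns of `normalizedCoeff`, without the square roots. -/
noncomputable def gram (Q : Finset (Finset (Fin N))) (S : ℕ) (α : PauliString N → ℝ)
    (ρ : Fin n → QMat N) (a b : Fin n) : ℝ :=
  ∑ p ∈ rows Q S, pauliCoeff (ρ a) p * pauliCoeff (ρ b) p / α p

lemma gram_self_nonneg (hα : ∀ p ∈ rows Q S, 0 < α p) (ρ : Fin n → QMat N) (a : Fin n) :
    0 ≤ gram Q S α ρ a a :=
  Finset.sum_nonneg fun p hp => div_nonneg (mul_self_nonneg _) (hα p hp).le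

lemma integral_gram_self (hS : 1 ≤ S) (hQ : ∀ s ∈ Q, s.card = S)
    (hα : ∀ p ∈ rows Q S, 0 < α p) (h : IsUncorrelatedEnsemble μ ρ α) (a : Fin n) :
    ∫ ω, gram Q S α (fun a => ρ a ω) a a ∂μ = (rows Q S).card := by
  have hi : ∀ p ∈ rows Q S, Integrable (fun ω =>
      pauliCoeff (ρ a ω) p * pauliCoeff (ρ a ω) p / α p) μ := fun p hp =>
    (integrable_pauliCoeff_mul h a (ne_zero_of_mem_rows hS hQ hp) (ne_zero_of_mem_rows hS hQ hp)
      (hα p hp) (hα p hp)).div_const _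
  simp only [gram]
  rw [integral_finsetSum _ hi, Finset.card_eq_sum_ones]
  push_cast
  refine Finset.sum_congr rfl fun p hp => ?_
  have hp0 := ne_zero_of_mem_rows hS hQ hp
  rw [integral_div, h.cov a a p p hp0 hp0]
  simp [(hα p hp).ne']

/-- For independent states the expectation of the square factorises over the two states, and only
the diagonal of the covariance matrix survives. -/
lemma integral_gram_sq (hS : 1 ≤ S) (hQ : ∀ s ∈ Q, s.card = S)
    (hα : ∀ p ∈ rows Q S, 0 < α p) (h : IsUncorrelatedEnsemble μ ρ α) {a b : Fin n}
    (hab : a ≠ b) :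
    Integrable (fun ω => gram Q S α (fun a => ρ a ω) a b ^ 2) μ ∧
      ∫ ω, gram Q S α (fun a => ρ a ω) a b ^ 2 ∂μ = (rows Q S).card := by
  set F : Fin n → PauliString N → PauliString N → Ω → ℝ := fun a p q ω =>
    pauliCoeff (ρ a ω) p * pauliCoeff (ρ a ω) q with hF
  have hexp : ∀ ω, gram Q S α (fun a => ρ a ω) a b ^ 2 =
      ∑ p ∈ rows Q S, ∑ q ∈ rows Q S, (F a p q ω * F b p q ω) / (α p * α q) := by
    intro ω
    rw [gram, pow_two, Finset.sum_mul_sum]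
    refine Finset.sum_congr rfl fun p _ => Finset.sum_congr rfl fun q _ => ?_
    rw [div_mul_div_comm]
    simp only [hF]
    ring
  have hind : ∀ p q, IndepFun (F a p q) (F b p q) μ := fun p q =>
    (h.indep.indepFun hab).comp
      (φ := fun M => pauliCoeff (Matrix.of M) p * pauliCoeff (Matrix.of M) q)
      (ψ := fun M => pauliCoeff (Matrix.of M) p * pauliCoeff (Matrix.of M) q)
      ((measurable_pauliCoeff p).mul (measurable_pauliCoeff q))
      ((measurable_pauliCoeff p).mul (measurable_pauliCoeff q))
  have hFi : ∀ c, ∀ p ∈ rows Q S, ∀ q ∈ rows Q S, Integrable (F c p q) μ := fun c p hp q hq =>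
    integrable_pauliCoeff_mul h c (ne_zero_of_mem_rows hS hQ hp) (ne_zero_of_mem_rows hS hQ hq)
      (hα p hp) (hα q hq)
  have hi : ∀ p ∈ rows Q S, ∀ q ∈ rows Q S, Integrable (fun ω =>
      (F a p q ω * F b p q ω) / (α p * α q)) μ := fun p hp q hq =>
    ((hind p q).integrable_mul (hFi a p hp q hq) (hFi b p hp q hq)).div_const _
  simp only [hexp]
  refine ⟨integrable_finsetSum _ fun p hp => integrable_finsetSum _ fun q hq => hi p hp q hq, ?_⟩
  rw [integral_finsetSum _ fun p hp => integrable_finsetSum _ fun q hq => hi p hp q hq,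
    Finset.card_eq_sum_ones]
  push_cast
  refine Finset.sum_congr rfl fun p hp => ?_
  have hp0 := ne_zero_of_mem_rows hS hQ hp
  rw [integral_finsetSum _ fun q hq => hi p hp q hq, Finset.sum_eq_single_of_mem p hp]
  · rw [integral_div, (hind p p).integral_fun_mul_eq_mul_integral
      (hFi a p hp p hp).aestronglyMeasurable (hFi b p hp p hp).aestronglyMeasurable]
    simp only [hF]
    rw [h.cov a a p p hp0 hp0, h.cov b b p p hp0 hp0]
    simp [(hα p hp).ne']
  · intro q hq hqp
    have hq0 := ne_zero_of_mem_rows hS hQ hq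
    rw [integral_div, (hind p q).integral_fun_mul_eq_mul_integral
      (hFi a p hp q hq).aestronglyMeasurable (hFi b p hp q hq).aestronglyMeasurable]
    simp only [hF]
    rw [h.cov a a p q hp0 hq0]
    simp [hqp.symm]

lemma measure_offDiag_gram_le (hS : 1 ≤ S) (hQ : ∀ s ∈ Q, s.card = S)
    (hα : ∀ p ∈ rows Q S, 0 < α p) (h : IsUncorrelatedEnsemble μ ρ α) {t : ℝ} (ht : 0 < t) :
    μ.real {ω | t ≤ ∑ a, ∑ b ∈ Finset.univ.erase a, gram Q S α (fun a => ρ a ω) a b ^ 2} ≤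
      (n : ℝ) ^ 2 * (rows Q S).card / t := by
  have hi : ∀ a, ∀ b ∈ Finset.univ.erase a,
      Integrable (fun ω => gram Q S α (fun a => ρ a ω) a b ^ 2) μ := fun a b hb =>
    (integral_gram_sq hS hQ hα h (Finset.ne_of_mem_erase hb).symm).1
  have hI : Integrable (fun ω => ∑ a, ∑ b ∈ Finset.univ.erase a,
      gram Q S α (fun a => ρ a ω) a b ^ 2) μ :=
    integrable_finsetSum _ fun a _ => integrable_finsetSum _ fun b hb => hi a b hb
  have hm := mul_meas_ge_le_integral_of_nonneg (ae_of_all _ fun ω =>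
    Finset.sum_nonneg fun a _ => Finset.sum_nonneg fun b _ => sq_nonneg _) hI t
  rw [le_div_iff₀ ht, mul_comm]
  refine hm.trans ?_
  rw [integral_finsetSum _ fun a _ => integrable_finsetSum _ fun b hb => hi a b hb]
  calc _ = ∑ a : Fin n, ∑ b ∈ Finset.univ.erase a, ((rows Q S).card : ℝ) := by
        refine Finset.sum_congr rfl fun a _ => ?_
        rw [integral_finsetSum _ fun b hb => hi a b hb]
        exact Finset.sum_congr rfl fun b hb =>
          (integral_gram_sq hS hQ hα h (Finset.ne_of_mem_erase hb).symm).2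
    _ ≤ ∑ a : Fin n, ∑ b : Fin n, ((rows Q S).card : ℝ) :=
        Finset.sum_le_sum fun a _ => Finset.sum_le_sum_of_subset_of_nonneg
          (Finset.erase_subset _ _) fun _ _ _ => Nat.cast_nonneg _
    _ = _ := by simp; ring

/-- The columns are independent, so the product of their normalised squared norms has mean one,
and Markov's inequality applies. -/
lemma measure_prod_gram_le (hS : 1 ≤ S) (hQ : ∀ s ∈ Q, s.card = S) (hne : Q.Nonempty)
    (hα : ∀ p ∈ rows Q S, 0 < α p) (h : IsUncorrelatedEnsemble μ ρ α) {t : ℝ} (ht : 0 < t) :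
    μ.real {ω | t ≤ ∏ a, gram Q S α (fun a => ρ a ω) a a / (rows Q S).card} ≤ 1 / t := by
  set f : ((Fin N → Fin 2) → (Fin N → Fin 2) → ℂ) → ℝ := fun M =>
    ∑ p ∈ rows Q S, pauliCoeff (Matrix.of M) p * pauliCoeff (Matrix.of M) p / α p /
      (rows Q S).card with hf
  have hfm : Measurable f := Finset.measurable_fun_sum _ fun p _ =>
    (((measurable_pauliCoeff p).mul (measurable_pauliCoeff p)).div_const _).div_const _
  have hfe : ∀ a ω, gram Q S α (fun a => ρ a ω) a a / (rows Q S).card =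
      f (fun x y => ρ a ω x y) := fun a ω => by
    rw [gram, Finset.sum_div]; rfl
  have hind : iIndepFun (fun a ω => f (fun x y => ρ a ω x y)) μ :=
    h.indep.comp (fun _ => f) fun _ => hfm
  have hcard : ((rows Q S).card : ℝ) ≠ 0 := by
    exact_mod_cast (rows_nonempty hS hQ hne).card_pos.ne'
  have hint1 : ∀ a, ∫ ω, f (fun x y => ρ a ω x y) ∂μ = 1 := fun a => by
    simp only [← hfe]
    rw [integral_div, integral_gram_self hS hQ hα h a, div_self hcard]
  have hprod : ∫ ω, ∏ a, f (fun x y => ρ a ω x y) ∂μ = 1 := by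
    rw [hind.integral_fun_prod_eq_prod_integral fun a =>
      (hfm.comp (measurable_entries h a)).aestronglyMeasurable]
    simp [hint1]
  have hI : Integrable (fun ω => ∏ a, f (fun x y => ρ a ω x y)) μ := by
    by_contra hc
    rw [integral_undef hc] at hprod
    exact zero_ne_one hprod
  simp only [hfe]
  have hm := mul_meas_ge_le_integral_of_nonneg (ae_of_all _ fun ω =>
    Finset.prod_nonneg fun a _ => by
      rw [← hfe]
      exact div_nonneg (gram_self_nonneg hα _ a) (Nat.cast_nonneg _)) hI t
  rw [hprod] at hm
  rw [le_div_iff₀ ht, mul_comm]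
  exact hm

end Ensemble

/-! ### Eigenvalues of the kernel outside the exceptional events -/

section Kernel

variable {N n S D : ℕ} {Q : Finset (Finset (Fin N))} {α : PauliString N → ℝ}

/-- The quadratic form of the kernel counts how often each gate is used. -/
lemma dotProduct_qntk_mulVec (o : Fin N → ℝ) (P : Fin D → PauliString N)
    (hP : ∀ d, supp (P d) ∈ Q) (hQ : ∀ s ∈ Q, s.card = S) (ρ : Fin n → QMat N) (v : Fin n → ℝ) :
    v ⬝ᵥ (qntk (observable o) (fun d => pauliTensor (P d)) ρ 0).mulVec v =
      1 / D * ∑ p ∈ rows Q S, ((Finset.univ.filter fun d => P d = p).card : ℝ) *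
        derivOp o (fun p => ∑ a, v a * pauliCoeff (ρ a) p) p ^ 2 := by
  set u : PauliString N → ℝ := fun p => ∑ a, v a * pauliCoeff (ρ a) p with hu
  have hJ : (jacobian (observable o) (fun d => pauliTensor (P d)) ρ 0).mulVec v =
      fun d => derivOp o u (P d) := by
    funext d
    simp only [Matrix.mulVec, dotProduct, jacobian_zero, derivOp, hu, Finset.sum_mul,
      Finset.mul_sum]
    rw [Finset.sum_comm]
    exact Finset.sum_congr rfl fun q _ => Finset.sum_congr rfl fun a _ => by ring
  rw [qntk, Matrix.smul_mulVec, dotProduct_smul, ← Matrix.mulVec_mulVec, hJ,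
    Matrix.dotProduct_mulVec, Matrix.vecMul_transpose, hJ, smul_eq_mul]
  congr 1
  calc (fun d => derivOp o u (P d)) ⬝ᵥ (fun d => derivOp o u (P d))
      = ∑ d, derivOp o u (P d) ^ 2 := Finset.sum_congr rfl fun d _ => (pow_two _).symm
    _ = ∑ d, ∑ p ∈ rows Q S, if P d = p then derivOp o u p ^ 2 else 0 := by
        refine Finset.sum_congr rfl fun d _ => ?_
        rw [Finset.sum_ite_eq]
        split_ifs with h
        · rfl
        · rw [derivOp_eq_zero o u hQ (hP d) h]; ring
    _ = _ := by
        rw [Finset.sum_comm]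
        refine Finset.sum_congr rfl fun p _ => ?_
        rw [← Finset.sum_filter, Finset.sum_const, nsmul_eq_mul]

lemma sum_sq_div_eq_gram (ρ : Fin n → QMat N) (v : Fin n → ℝ) :
    ∑ p ∈ rows Q S, (∑ a, v a * pauliCoeff (ρ a) p) ^ 2 / α p =
      ∑ a, v a ^ 2 * gram Q S α ρ a a +
        ∑ a, ∑ b ∈ Finset.univ.erase a, v a * v b * gram Q S α ρ a b := by
  have h : ∑ p ∈ rows Q S, (∑ a, v a * pauliCoeff (ρ a) p) ^ 2 / α p =
      ∑ a, ∑ b, v a * v b * gram Q S α ρ a b := by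
    have hp : ∀ p, (∑ a, v a * pauliCoeff (ρ a) p) ^ 2 / α p =
        ∑ a, ∑ b, v a * v b * (pauliCoeff (ρ a) p * pauliCoeff (ρ b) p / α p) := fun p => by
      rw [pow_two, Finset.sum_mul_sum, Finset.sum_div]
      refine Finset.sum_congr rfl fun a _ => ?_
      rw [Finset.sum_div]
      exact Finset.sum_congr rfl fun b _ => by ring
    simp only [hp, gram, Finset.mul_sum]
    rw [Finset.sum_comm]
    exact Finset.sum_congr rfl fun a _ => Finset.sum_comm
  rw [h, ← Finset.sum_add_distrib]
  refine Finset.sum_congr rfl fun a _ => ?_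
  rw [← Finset.add_sum_erase _ _ (Finset.mem_univ a)]
  ring

lemma abs_offDiag_le (G : Fin n → Fin n → ℝ) (v : Fin n → ℝ) {c : ℝ} (hc : 0 ≤ c)
    (hG : ∑ a, ∑ b ∈ Finset.univ.erase a, G a b ^ 2 ≤ c ^ 2) :
    |∑ a, ∑ b ∈ Finset.univ.erase a, v a * v b * G a b| ≤ c * ∑ a, v a ^ 2 := by
  have hv : 0 ≤ ∑ a, v a ^ 2 := Finset.sum_nonneg fun a _ => sq_nonneg _
  refine abs_le_of_sq_le_sq ?_ (mul_nonneg hc hv)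
  rw [Finset.sum_sigma'] at hG ⊢
  calc _ ≤ _ := Finset.sum_mul_sq_le_sq_mul_sq _ (fun x : (_ : Fin n) × Fin n => v x.1 * v x.2)
        fun x => G x.1 x.2
    _ ≤ (∑ a, v a ^ 2) ^ 2 * c ^ 2 := by
        refine mul_le_mul ?_ hG (Finset.sum_nonneg fun _ _ => sq_nonneg _) (sq_nonneg _)
        rw [← Finset.sum_sigma' Finset.univ (fun a => Finset.univ.erase a)
          fun a b => (v a * v b) ^ 2, pow_two (∑ a, v a ^ 2), Finset.sum_mul_sum]
        refine Finset.sum_le_sum fun a _ => ?_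
        simp only [mul_pow]
        exact Finset.sum_le_sum_of_subset_of_nonneg (Finset.erase_subset _ _)
          fun _ _ _ => by positivity
    _ = _ := by ring

lemma alpha_bounds {p : PauliString N} (hp : p ∈ rows Q S) :
    alphaMin Q S α ≤ α p ∧ α p ≤ alphaMax Q S α := by
  have hfin : (α '' (rows Q S : Set (PauliString N))).Finite :=
    (Finset.finite_toSet _).image _
  exact ⟨csInf_le hfin.bddBelow ⟨p, hp, rfl⟩, le_csSup hfin.bddAbove ⟨p, hp, rfl⟩⟩

lemma alphaMin_pos (hne : (rows Q S).Nonempty) (hα : ∀ p ∈ rows Q S, 0 < α p) :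
    0 < alphaMin Q S α := by
  have hfin : (α '' (rows Q S : Set (PauliString N))).Finite :=
    (Finset.finite_toSet _).image _
  obtain ⟨p, hp, h⟩ := (hne.to_set.image α).csInf_mem hfin
  rw [alphaMin, ← h]
  exact hα p hp

lemma columnNorm_sq (hQ : ∀ s ∈ Q, s.card = S) (hα : ∀ p ∈ rows Q S, 0 < α p)
    (ρ : Fin n → QMat N) (a : Fin n) :
    columnNorm Q S α ρ a ^ 2 = gram Q S α ρ a a / (rows Q S).card := by
  have h : ∑ p, normalizedCoeff Q S α ρ p a ^ 2 = gram Q S α ρ a a := by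
    rw [gram, ← Finset.sum_coe_sort (rows Q S)]
    refine Finset.sum_congr rfl fun p _ => ?_
    rw [normalizedCoeff, Matrix.of_apply, div_pow, Real.sq_sqrt (hα p p.2).le, pow_two]
  rw [columnNorm, ← card_rows_real hQ, h, mul_pow, div_pow, one_pow,
    Real.sq_sqrt (Nat.cast_nonneg _), Real.sq_sqrt (gram_self_nonneg hα ρ a)]
  ring

lemma columnNorm_nonneg (ρ : Fin n → QMat N) (a : Fin n) : 0 ≤ columnNorm Q S α ρ a :=
  mul_nonneg (by positivity) (Real.sqrt_nonneg _)

lemma colMin_le (ρ : Fin n → QMat N) (a : Fin n) : colMin Q S α ρ ≤ columnNorm Q S α ρ a :=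
  ciInf_le (Set.finite_range _).bddBelow a

lemma le_colMax (ρ : Fin n → QMat N) (a : Fin n) : columnNorm Q S α ρ a ≤ colMax Q S α ρ :=
  le_ciSup (Set.finite_range (fun a => columnNorm Q S α ρ a)).bddAbove a

/-- When each gate is used about equally often and the columns of `normalizedCoeff` are almost
orthogonal, the eigenvalues of the kernel are controlled. -/
lemma eigenvalue_bounds (o : Fin N → ℝ) (P : Fin D → PauliString N)
    (hD : 0 < D) (hP : ∀ d, supp (P d) ∈ Q) (hQ : ∀ s ∈ Q, s.card = S) (hS : 1 ≤ S)
    (hne : Q.Nonempty) (hα : ∀ p ∈ rows Q S, 0 < α p) (hΔ : 0 < Delta o S)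
    (ρ : Fin n → QMat N) {η ε : ℝ} (hη1 : η < 1) (hη0 : 0 < η) (hε0 : 0 ≤ ε)
    (hcount : ∀ p, supp p ∈ Q →
      |((Finset.univ.filter fun d => P d = p).card : ℝ) - D / (3 ^ S * Q.card)| ≤
        η * (D / (3 ^ S * Q.card)))
    (hmin : 0 ≤ colMin Q S α ρ)
    (hoff : ∑ a, ∑ b ∈ Finset.univ.erase a, gram Q S α ρ a b ^ 2 ≤
      ((rows Q S).card * ε) ^ 2)
    {lam : ℝ} (hlam : Module.End.HasEigenvalue (Matrix.toLin' (qntk (observable o)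
      (fun d => pauliTensor (P d)) ρ 0)) lam) :
    (1 - η) * (((3 : ℝ) ^ S - 1) / 3 ^ S) * Delta o S * alphaMin Q S α *
      (colMin Q S α ρ ^ 2 - ε) ≤ lam ∧
    lam ≤ (1 + η) * (((3 : ℝ) ^ S - 1) / 3 ^ S) * specNorm (observable o) ^ 2 *
      alphaMax Q S α * (colMax Q S α ρ ^ 2 + ε) := by
  obtain ⟨v, hv⟩ := hlam.exists_hasEigenvector
  have hKv : (qntk (observable o) (fun d => pauliTensor (P d)) ρ 0).mulVec v = lam • v := by
    rw [← Matrix.toLin'_apply]; exact hv.apply_eq_smul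
  have hvv : 0 < ∑ a, v a ^ 2 := by
    obtain ⟨a, ha⟩ := Function.ne_iff.mp hv.2
    exact Finset.sum_pos' (fun a _ => sq_nonneg _)
      ⟨a, Finset.mem_univ a, by have : v a ≠ 0 := ha; positivity⟩
  have hquad := dotProduct_qntk_mulVec o P hP hQ ρ v
  have hvd : v ⬝ᵥ (lam • v) = lam * ∑ a, v a ^ 2 := by
    rw [dotProduct_smul, smul_eq_mul]
    congr 1
    exact Finset.sum_congr rfl fun a _ => (pow_two _).symm
  rw [hKv, hvd] at hquad
  set u : PauliString N → ℝ := fun p => ∑ a, v a * pauliCoeff (ρ a) p with hu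
  set V := ∑ a, v a ^ 2 with hV
  set M : ℝ := ((rows Q S).card : ℝ) with hM
  have hMpos : 0 < M := by
    rw [hM]; exact_mod_cast (rows_nonempty hS hQ hne).card_pos
  have hMr : M = ((3 : ℝ) ^ S - 1) * Q.card := card_rows_real hQ
  have hQpos : (0 : ℝ) < Q.card := by exact_mod_cast hne.card_pos
  have hDpos : (0 : ℝ) < D := by exact_mod_cast hD
  set M0 : ℝ := 3 ^ S * Q.card with hM0
  have hM0pos : 0 < M0 := by positivity
  have hratio : ((3 : ℝ) ^ S - 1) / 3 ^ S = M / M0 := by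
    rw [hMr, hM0]; field_simp
  -- replace the counts by their expectations
  have hB := sum_derivOp_sq_bounds o hQ u
  set T := ∑ p ∈ rows Q S, derivOp o u p ^ 2 with hT
  have hlow1 : (1 - η) / M0 * T ≤ lam * V := by
    rw [hquad, hT, Finset.mul_sum, Finset.mul_sum]
    refine Finset.sum_le_sum fun p hp => ?_
    have := (abs_le.mp (hcount p (Finset.mem_filter.mp hp).2.1)).1
    rw [← mul_assoc]
    refine mul_le_mul_of_nonneg_right ?_ (sq_nonneg _)
    rw [one_div_mul_eq_div, le_div_iff₀ hDpos]
    calc (1 - η) / M0 * D = D / M0 - η * (D / M0) := by ring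
      _ ≤ _ := by linarith
  have hup1 : lam * V ≤ (1 + η) / M0 * T := by
    rw [hquad, hT, Finset.mul_sum, Finset.mul_sum]
    refine Finset.sum_le_sum fun p hp => ?_
    have := (abs_le.mp (hcount p (Finset.mem_filter.mp hp).2.1)).2
    rw [← mul_assoc]
    refine mul_le_mul_of_nonneg_right ?_ (sq_nonneg _)
    rw [one_div_mul_eq_div, div_le_iff₀ hDpos]
    calc _ ≤ D / M0 + η * (D / M0) := by linarith
      _ = _ := by ring
  have hαm := alphaMin_pos (rows_nonempty hS hQ hne) hα
  obtain ⟨p0, hp0⟩ := rows_nonempty hS hQ hne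
  have hαM : 0 < alphaMax Q S α := (hα p0 hp0).trans_le (alpha_bounds hp0).2
  set U := ∑ p ∈ rows Q S, u p ^ 2 / α p with hU
  have hu1 : alphaMin Q S α * U ≤ ∑ p ∈ rows Q S, u p ^ 2 := by
    rw [hU, Finset.mul_sum]
    refine Finset.sum_le_sum fun p hp => ?_
    rw [mul_div_assoc', div_le_iff₀ (hα p hp), mul_comm]
    exact mul_le_mul_of_nonneg_left (alpha_bounds hp).1 (sq_nonneg _)
  have hu2 : ∑ p ∈ rows Q S, u p ^ 2 ≤ alphaMax Q S α * U := by
    rw [hU, Finset.mul_sum]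
    refine Finset.sum_le_sum fun p hp => ?_
    rw [mul_div_assoc', le_div_iff₀ (hα p hp), mul_comm (alphaMax Q S α)]
    exact mul_le_mul_of_nonneg_left (alpha_bounds hp).2 (sq_nonneg _)
  have hgram : ∀ a, gram Q S α ρ a a = M * columnNorm Q S α ρ a ^ 2 := fun a => by
    rw [columnNorm_sq hQ hα, ← hM]; field_simp
  have hoff' := abs_le.mp (abs_offDiag_le (fun a b => gram Q S α ρ a b) v
    (mul_nonneg hMpos.le hε0) hoff)
  have hUe : U = _ := sum_sq_div_eq_gram (Q := Q) (S := S) (α := α) ρ v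
  have hUlow : M * (colMin Q S α ρ ^ 2 - ε) * V ≤ U := by
    have : M * colMin Q S α ρ ^ 2 * V ≤ ∑ a, v a ^ 2 * gram Q S α ρ a a := by
      rw [hV, Finset.mul_sum]
      refine Finset.sum_le_sum fun a _ => ?_
      rw [hgram, mul_comm]
      have := colMin_le (Q := Q) (S := S) (α := α) ρ a
      gcongr
    rw [hUe]
    linarith [hoff'.1]
  have hUup : U ≤ M * (colMax Q S α ρ ^ 2 + ε) * V := by
    have : ∑ a, v a ^ 2 * gram Q S α ρ a a ≤ M * colMax Q S α ρ ^ 2 * V := by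
      rw [hV, Finset.mul_sum]
      refine Finset.sum_le_sum fun a _ => ?_
      rw [hgram, mul_comm]
      have h1 := le_colMax (Q := Q) (S := S) (α := α) ρ a
      have h2 := columnNorm_nonneg (Q := Q) (S := S) (α := α) ρ a
      gcongr
    rw [hUe]
    linarith [hoff'.2]
  rw [hratio]
  have hη' : 0 < 1 - η := by linarith
  constructor
  · refine le_of_mul_le_mul_right ?_ hvv
    calc _ = (1 - η) / M0 * (Delta o S * (alphaMin Q S α *
          (M * (colMin Q S α ρ ^ 2 - ε) * V))) := by ring
      _ ≤ (1 - η) / M0 * (Delta o S * (alphaMin Q S α * U)) := by gcongr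
      _ ≤ (1 - η) / M0 * (Delta o S * ∑ p ∈ rows Q S, u p ^ 2) := by gcongr
      _ ≤ (1 - η) / M0 * T := by gcongr; exact hB.1
      _ ≤ _ := hlow1
  · refine le_of_mul_le_mul_right ?_ hvv
    have hsum0 : 0 ≤ ∑ q, |o q| := Finset.sum_nonneg fun _ _ => abs_nonneg _
    have hsp := sum_abs_le_specNorm o
    have hu0 : 0 ≤ ∑ p ∈ rows Q S, u p ^ 2 := Finset.sum_nonneg fun _ _ => sq_nonneg _
    calc _ ≤ (1 + η) / M0 * T := hup1
      _ ≤ (1 + η) / M0 * ((∑ q, |o q|) ^ 2 * ∑ p ∈ rows Q S, u p ^ 2) := by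
          gcongr; exact hB.2
      _ ≤ (1 + η) / M0 * (specNorm (observable o) ^ 2 * (alphaMax Q S α * U)) := by gcongr
      _ ≤ (1 + η) / M0 * (specNorm (observable o) ^ 2 * (alphaMax Q S α *
          (M * (colMax Q S α ρ ^ 2 + ε) * V))) := by gcongr
      _ = _ := by ring

end Kernel

/-! ### Consequences of the size conditions -/

lemma one_le_log_natCast {n : ℕ} (hn : 5 ≤ n) : 1 ≤ Real.log n := by
  have h5 : (5 : ℝ) ≤ n := by exact_mod_cast hn
  rw [Real.le_log_iff_exp_le (by linarith)]
  linarith [Real.exp_one_lt_d9]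

section Sizes

variable {n S : ℕ} {B δ k q : ℝ}

/-- The requirement on the number of qubits of a gate, in the form in which it is used. -/
lemma le_mul_of_logb_le (hn : 5 ≤ n) (hB : 0 < B) (hδ : 0 < δ) (hk : 0 < k) (hq : 0 < q)
    (h : Real.logb 3 (1 + 8 ^ 2 * (n : ℝ) ^ 2 * Real.log n / (k ^ 2 * B ^ 2 * q * δ ^ 2)) ≤ S) :
    64 * (n : ℝ) ^ 2 * Real.log n ≤ (3 ^ S - 1) * q * (k ^ 2 * B ^ 2 * δ ^ 2) := by
  have hl := one_le_log_natCast hn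
  rw [Real.logb_le_iff_le_rpow (by norm_num) (by positivity), Real.rpow_natCast] at h
  have h2 : 8 ^ 2 * (n : ℝ) ^ 2 * Real.log n / (k ^ 2 * B ^ 2 * q * δ ^ 2) ≤ 3 ^ S - 1 := by
    linarith
  rw [div_le_iff₀ (by positivity)] at h2
  calc 64 * (n : ℝ) ^ 2 * Real.log n = 8 ^ 2 * (n : ℝ) ^ 2 * Real.log n := by norm_num
    _ ≤ _ := h2
    _ = _ := by ring

/-- If `B` is the smallest squared column norm, the product of all of them bounds `B ^ 5 δ`. -/
lemma pow_five_mul_lt (hn : 5 ≤ n) (hB : 1 ≤ B) (hδ : 0 < δ) (h : B ^ n < 4 / δ) :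
    B ^ 5 * δ < 4 := by
  rw [← lt_div_iff₀ hδ]
  exact (pow_le_pow_right₀ hB hn).trans_lt h

/-- A large smallest column norm forces the number `M` of rows to be large: `B ^ 5 δ < 4` and
`M B² δ² ≥ 1` leave room for `δ` only if `B ^ 8 ≤ 16 M`. -/
lemma pow_eight_le {M : ℝ} (hn : 5 ≤ n) (hB : 0 < B) (hδ : 0 < δ) (hk : 0 < k) (hk1 : k < 1)
    (h : B ^ n < 4 / δ) (hM : 1 ≤ M)
    (hS : 64 * (n : ℝ) ^ 2 * Real.log n ≤ M * (k ^ 2 * B ^ 2 * δ ^ 2)) : B ^ 8 ≤ 16 * M := by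
  rcases le_or_gt B 1 with hB1 | hB1
  · have := pow_le_one₀ (n := 8) hB.le hB1
    linarith
  · have h5 := pow_five_mul_lt hn hB1.le hδ h
    have hl := one_le_log_natCast hn
    have hn' : (5 : ℝ) ≤ n := by exact_mod_cast hn
    have h1 : 1 ≤ M * (B ^ 2 * δ ^ 2) := by
      have hk2 : k ^ 2 ≤ 1 := pow_le_one₀ hk.le hk1.le
      calc (1 : ℝ) ≤ 64 * (n : ℝ) ^ 2 * Real.log n := by nlinarith
        _ ≤ _ := hS
        _ = k ^ 2 * (M * (B ^ 2 * δ ^ 2)) := by ring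
        _ ≤ 1 * (M * (B ^ 2 * δ ^ 2)) := by gcongr
        _ = _ := one_mul _
    have h2 : (B ^ 5 * δ) ^ 2 ≤ 4 ^ 2 := by gcongr
    calc B ^ 8 = B ^ 8 * 1 := (mul_one _).symm
      _ ≤ B ^ 8 * (M * (B ^ 2 * δ ^ 2)) := by gcongr
      _ = (B ^ 5 * δ) ^ 2 * M := by ring
      _ ≤ 4 ^ 2 * M := by gcongr
      _ = _ := by norm_num

/-- If there are `M` rows, the Markov threshold for the squared Frobenius norm of the off-diagonal
part of the Gram matrix is at most the square of `k / 4` times the smallest diagonal entry `M B`. -/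
lemma offDiag_threshold_le {M : ℝ} (hn : 5 ≤ n) (hδ : 0 < δ) (hδ1 : δ < 1)
    (hM : 1 ≤ M)
    (hS : 64 * (n : ℝ) ^ 2 * Real.log n ≤ M * (k ^ 2 * B ^ 2 * δ ^ 2)) :
    4 * (n : ℝ) ^ 2 * M / δ ≤ (M * (k / 4 * B)) ^ 2 := by
  have hl := one_le_log_natCast hn
  rw [div_le_iff₀ hδ]
  have h1 : 4 * (n : ℝ) ^ 2 ≤ M * (k ^ 2 * B ^ 2 * δ) / 16 := by
    have h2 : 64 * (n : ℝ) ^ 2 ≤ 64 * (n : ℝ) ^ 2 * Real.log n :=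
      le_mul_of_one_le_right (by positivity) hl
    have h3 : M * (k ^ 2 * B ^ 2 * δ ^ 2) ≤ M * (k ^ 2 * B ^ 2 * δ) := by
      have : δ ^ 2 ≤ δ := by nlinarith
      gcongr
    linarith
  calc 4 * (n : ℝ) ^ 2 * M ≤ M * (k ^ 2 * B ^ 2 * δ) / 16 * M := by gcongr
    _ = _ := by ring

/-- If there are few groups, the requirement on `S` makes the factor `1 - 3⁻ˢ` negligible. -/
lemma two_div_le_pow (hn : 5 ≤ n) (hB : 0 < B) (hδ : 0 < δ) (hδ1 : δ < 1) (hk : 0 < k)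
    (hk1 : k < 1) (hq : 0 < q) (h : B ^ n < 4 / δ)
    (hS : 64 * (n : ℝ) ^ 2 * Real.log n ≤ (3 ^ S - 1) * q * (k ^ 2 * B ^ 2 * δ ^ 2))
    (hqn : q ≤ (n : ℝ) ^ 2 * Real.log n) : 2 / k ≤ (3 : ℝ) ^ S := by
  have hBδ : B * δ ≤ 4 := by
    rcases le_or_gt B 1 with hB1 | hB1
    · nlinarith
    · have h5 := pow_five_mul_lt hn hB1.le hδ h
      have : B * δ ≤ B ^ 5 * δ := by
        have := le_self_pow₀ (n := 5) hB1.le (by norm_num)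
        gcongr
      linarith
  have h3 : (1 : ℝ) ≤ 3 ^ S := one_le_pow₀ (by norm_num)
  have h1 : 64 ≤ (3 ^ S - 1) * (k ^ 2 * (B * δ) ^ 2) := by
    refine le_of_mul_le_mul_right ?_ hq
    calc 64 * q ≤ 64 * ((n : ℝ) ^ 2 * Real.log n) := by gcongr
      _ = 64 * (n : ℝ) ^ 2 * Real.log n := by ring
      _ ≤ _ := hS
      _ = _ := by ring
  have h2 : (3 ^ S - 1) * (k ^ 2 * (B * δ) ^ 2) ≤ (3 ^ S - 1) * (k * 4 ^ 2) := by
    have hk2 : k ^ 2 ≤ k := by nlinarith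
    have h0 : (0 : ℝ) ≤ 3 ^ S - 1 := by linarith
    gcongr
  rw [div_le_iff₀ hk]
  nlinarith

end Sizes

section Depth

variable {N n S D : ℕ} {Q : Finset (Finset (Fin N))} {α : PauliString N → ℝ}

/-- The required number of gates exceeds the number of possible gates by the factor that the
Chernoff bound needs. -/
lemma card_div_le_depthScale {δ k : ℝ} (hn : 5 ≤ n) (o : Fin N → ℝ) (hS1 : 1 ≤ S)
    (hQ : ∀ s ∈ Q, s.card = S) (hne : Q.Nonempty) (hα : ∀ p ∈ rows Q S, 0 < α p)
    (hΔ : 0 < Delta o S) (ρ : Fin n → QMat N) (hδ : 0 < δ) (hδ1 : δ < 1) (hk : 0 < k)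
    (hmin : 0 < colMin Q S α ρ)
    (h8 : (colMin Q S α ρ ^ 2) ^ 8 ≤ 16 * (3 ^ S * Q.card)) :
    64 * (3 ^ S * Q.card) / k ^ 2 ≤ depthScale 3276800 δ k o Q S α ρ := by
  set M0 : ℝ := 3 ^ S * Q.card with hM0
  set A := colMin Q S α ρ with hA
  set A' := colMax Q S α ρ with hA'
  set B := A ^ 2 with hB
  have hBpos : 0 < B := by positivity
  have hQpos : (0 : ℝ) < Q.card := by exact_mod_cast hne.card_pos
  have hM0pos : 0 < M0 := by positivity
  set W := (∑ q, |o q|) / √(Delta o S) with hW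
  have hW0 : 0 ≤ W := div_nonneg (Finset.sum_nonneg fun _ _ => abs_nonneg _) (Real.sqrt_nonneg _)
  have hcard := card_pow_le o hS1 hQ hne hΔ
  -- `16 · 160 ^ 16 ≤ 51200 ^ 8`, and `3276800 = 64 · 51200`
  have hMB : M0 * B ≤ 51200 * W ^ 4 := by
    have h1 : (M0 * B) ^ 8 ≤ (51200 * W ^ 4) ^ 8 := by
      calc (M0 * B) ^ 8 = M0 ^ 8 * B ^ 8 := by ring
        _ ≤ M0 ^ 8 * (16 * M0) := by gcongr
        _ = 16 * M0 ^ 9 := by ring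
        _ ≤ 16 * (160 ^ 16 * W ^ 32) := by gcongr
        _ = 16 * 160 ^ 16 * W ^ 32 := by ring
        _ ≤ 51200 ^ 8 * W ^ 32 := by gcongr; norm_num
        _ = _ := by ring
    exact le_of_pow_le_pow_left₀ (by norm_num) (by positivity) h1
  obtain ⟨a⟩ : Nonempty (Fin n) := ⟨⟨0, by omega⟩⟩
  have hAA : A ≤ A' := (colMin_le ρ a).trans (le_colMax ρ a)
  obtain ⟨p, hp⟩ := rows_nonempty hS1 hQ hne
  have hαm := alphaMin_pos ⟨p, hp⟩ hα
  have hαα : alphaMin Q S α ≤ alphaMax Q S α := (alpha_bounds hp).1.trans (alpha_bounds hp).2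
  have hlog : 1 ≤ Real.log (n / δ) := by
    refine (one_le_log_natCast hn).trans (Real.log_le_log (by positivity) ?_)
    rw [le_div_iff₀ hδ]
    exact mul_le_of_le_one_right (Nat.cast_nonneg n) hδ1.le
  have hn1 : (1 : ℝ) ≤ n := by exact_mod_cast (by omega : 1 ≤ n)
  have hW4 : W ^ 4 = (∑ q, |o q|) ^ 4 / Delta o S ^ 2 := by
    rw [hW, div_pow]
    congr 1
    rw [show (4 : ℕ) = 2 * 2 from rfl, pow_mul, Real.sq_sqrt hΔ.le]
  set F := specNorm (observable o) ^ 4 * alphaMax Q S α ^ 2 * A' ^ 2 /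
    (k ^ 2 * Delta o S ^ 2 * alphaMin Q S α ^ 2 * A ^ 4) with hF
  have hF1 : W ^ 4 / (k ^ 2 * B) ≤ F := by
    have hs0 : 0 ≤ ∑ q, |o q| := Finset.sum_nonneg fun _ _ => abs_nonneg _
    calc W ^ 4 / (k ^ 2 * B) = (∑ q, |o q|) ^ 4 * alphaMin Q S α ^ 2 * A ^ 2 /
          (k ^ 2 * Delta o S ^ 2 * alphaMin Q S α ^ 2 * A ^ 4) := by
          rw [hW4, hB]; field_simp
      _ ≤ F := by
          rw [hF]
          have := sum_abs_le_specNorm o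
          gcongr
  have hF0 : 0 ≤ F := le_trans (by positivity) hF1
  calc 64 * M0 / k ^ 2 = 64 * (M0 * B) / (k ^ 2 * B) := by field_simp
    _ ≤ 64 * (51200 * W ^ 4) / (k ^ 2 * B) := by gcongr
    _ = 3276800 * (W ^ 4 / (k ^ 2 * B)) := by ring
    _ ≤ 3276800 * F := by gcongr
    _ = 3276800 * F * 1 * 1 := by ring
    _ ≤ 3276800 * F * n * Real.log (n / δ) := by gcongr
    _ = _ := rfl

lemma log_le_of_depth {δ k M0 D₀ : ℝ} (hδ : 0 < δ) (hδ1 : δ < 1) (hk : 0 < k) (hk1 : k < 1)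
    (hM0 : 1 ≤ M0) (hD₀ : 64 * M0 / k ^ 2 ≤ D₀) (hD : D₀ * Real.log (D₀ / δ) ≤ D) :
    Real.log (4 * M0 / δ) ≤ D / M0 * (k / 4) ^ 2 / 4 := by
  have h64 : 4 * M0 ≤ D₀ := by
    refine le_trans ?_ hD₀
    rw [le_div_iff₀ (by positivity)]
    have : k ^ 2 ≤ 1 := pow_le_one₀ hk.le hk1.le
    nlinarith
  have hl : Real.log (4 * M0 / δ) ≤ Real.log (D₀ / δ) :=
    Real.log_le_log (by positivity) (by gcongr)
  have hl0 : 0 ≤ Real.log (4 * M0 / δ) := by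
    refine Real.log_nonneg ?_
    rw [le_div_iff₀ hδ]
    linarith
  have h1 : 64 * M0 / k ^ 2 * Real.log (4 * M0 / δ) ≤ D := by
    refine le_trans ?_ hD
    have : 0 ≤ D₀ := by linarith
    gcongr
  calc Real.log (4 * M0 / δ)
      = 64 * M0 / k ^ 2 * Real.log (4 * M0 / δ) / M0 * (k / 4) ^ 2 / 4 := by field_simp; ring
    _ ≤ _ := by gcongr

end Depth

/-- Two relative errors `k / 4`, in the counts and in the Gram matrix, combine to at most `k`. -/
lemma relative_error_bounds {k r x a B w a' B' lam : ℝ} (hk : 0 < k) (hk1 : k < 1) (hr : 0 ≤ r)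
    (hr1 : r ≤ 1) (hx : 0 ≤ x) (ha : 0 ≤ a) (hB : 0 ≤ B) (hw : 0 ≤ w) (ha' : 0 ≤ a')
    (hBB : B ≤ B') (hlo : (1 - k / 4) * r * x * a * (B - k / 4 * B) ≤ lam)
    (hup : lam ≤ (1 + k / 4) * r * w * a' * (B' + k / 4 * B)) :
    (1 - k) * r * x * a * B ≤ lam ∧ (1 - k / 2 ≤ r → (1 - k) * x * a * B ≤ lam) ∧
      lam ≤ (1 + k) * w * a' * B' := by
  have hlo' : (1 - k / 4) ^ 2 * r * (x * a * B) ≤ lam := by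
    refine le_trans (le_of_eq ?_) hlo
    ring
  have hG : 0 ≤ x * a * B := by positivity
  have hB' : 0 ≤ B' := hB.trans hBB
  have hk4 : 1 - k ≤ (1 - k / 4) ^ 2 := by nlinarith
  refine ⟨?_, fun hrk => ?_, ?_⟩
  · refine le_trans ?_ hlo'
    calc _ = (1 - k) * r * (x * a * B) := by ring
      _ ≤ _ := by gcongr
  · have h1 : 1 - k ≤ (1 - k / 4) ^ 2 * (1 - k / 2) := by
      nlinarith [mul_pos (mul_pos hk hk) (sub_pos.mpr hk1)]
    refine le_trans ?_ hlo'
    calc _ = (1 - k) * (x * a * B) := by ring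
      _ ≤ (1 - k / 4) ^ 2 * (1 - k / 2) * (x * a * B) := by gcongr
      _ ≤ _ := by gcongr
  · have h1 : (1 + k / 4) ^ 2 ≤ 1 + k := by nlinarith
    refine hup.trans ?_
    calc (1 + k / 4) * r * w * a' * (B' + k / 4 * B)
        ≤ (1 + k / 4) * 1 * w * a' * (B' + k / 4 * B') := by gcongr
      _ = (1 + k / 4) ^ 2 * (w * a' * B') := by ring
      _ ≤ (1 + k) * (w * a' * B') := by gcongr
      _ = _ := by ring

/-- The conclusion holds at every outcome that avoids the three exceptional events. -/
lemma eigenvalue_bounds_of_sizeConditions {N n S D : ℕ} {Q : Finset (Finset (Fin N))}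
    {α : PauliString N → ℝ} {δ k : ℝ} (hn : 5 ≤ n) (o : Fin N → ℝ) (P : Fin D → PauliString N)
    (hS1 : 1 ≤ S) (hne : Q.Nonempty) (hQ : ∀ s ∈ Q, s.card = S) (hΔ : 0 < Delta o S)
    (hα : ∀ p ∈ rows Q S, 0 < α p) (hP : ∀ d, supp (P d) ∈ Q) (ρ : Fin n → QMat N)
    (hδ : 0 < δ) (hδ1 : δ < 1) (hk : 0 < k) (hk1 : k < 1)
    (hcount : Real.log (4 * (3 ^ S * Q.card) / δ) ≤ D / (3 ^ S * Q.card) * (k / 4) ^ 2 / 4 →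
      ∀ p, supp p ∈ Q →
      |((Finset.univ.filter fun d => P d = p).card : ℝ) - D / (3 ^ S * Q.card)| ≤
        k / 4 * (D / (3 ^ S * Q.card)))
    (hprod : ∏ a, gram Q S α ρ a a / (rows Q S).card < 4 / δ)
    (hoff : ∑ a, ∑ b ∈ Finset.univ.erase a, gram Q S α ρ a b ^ 2 <
      4 * (n : ℝ) ^ 2 * (rows Q S).card / δ)
    (hsize : SizeConditions 8 3276800 δ k D o Q S α ρ)
    {lam : ℝ} (hlam : Module.End.HasEigenvalue (Matrix.toLin' (qntk (observable o)
      (fun d => pauliTensor (P d)) ρ 0)) lam) :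
    (1 - k) * (((3 : ℝ) ^ S - 1) / 3 ^ S) * Delta o S * alphaMin Q S α *
        colMin Q S α ρ ^ 2 ≤ lam ∧
      ((Q.card : ℝ) ≤ (n : ℝ) ^ 2 * Real.log n ∨ 2 / k ≤ (3 : ℝ) ^ S →
        (1 - k) * Delta o S * alphaMin Q S α * colMin Q S α ρ ^ 2 ≤ lam) ∧
      lam ≤ (1 + k) * specNorm (observable o) ^ 2 * alphaMax Q S α * colMax Q S α ρ ^ 2 := by
  obtain ⟨hmin, hdepth, hS⟩ := hsize
  set A := colMin Q S α ρ with hA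
  set B := A ^ 2 with hB
  have hBpos : 0 < B := by positivity
  have hQpos : (0 : ℝ) < Q.card := by exact_mod_cast hne.card_pos
  have hQ1 : (1 : ℝ) ≤ Q.card := by exact_mod_cast hne.card_pos
  have hM1 : (1 : ℝ) ≤ (rows Q S).card := by
    exact_mod_cast (rows_nonempty hS1 hQ hne).card_pos
  have hS' := le_mul_of_logb_le hn hBpos hδ hk hQpos
    (by rw [hB, ← pow_mul]; exact hS)
  have hSM := hS'
  rw [← card_rows_real hQ] at hSM
  have h3 : (3 : ℝ) ≤ 3 ^ S := by
    calc (3 : ℝ) = 3 ^ 1 := (pow_one _).symm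
      _ ≤ 3 ^ S := pow_le_pow_right₀ (by norm_num) hS1
  have hMM0 : ((rows Q S).card : ℝ) ≤ 3 ^ S * Q.card := by
    rw [card_rows_real hQ]; nlinarith
  have hM01 : (1 : ℝ) ≤ 3 ^ S * Q.card := hM1.trans hMM0
  have hBn : B ^ n < 4 / δ := by
    refine lt_of_le_of_lt ?_ hprod
    calc B ^ n = ∏ _a : Fin n, B := by simp
      _ ≤ _ := by
        refine Finset.prod_le_prod (fun _ _ => hBpos.le) fun a _ => ?_
        rw [← columnNorm_sq hQ hα]
        exact pow_le_pow_left₀ hmin.le (colMin_le ρ a) 2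
  have h8 := pow_eight_le hn hBpos hδ hk hk1 hBn hM1 hSM
  have hD₀ := card_div_le_depthScale (δ := δ) (k := k) hn o hS1 hQ hne hα hΔ ρ hδ hδ1 hk hmin
    (h8.trans (by linarith))
  have hlogD := log_le_of_depth hδ hδ1 hk hk1 hM01 hD₀ hdepth
  have hD : 0 < D := by
    by_contra hD
    obtain rfl : D = 0 := by omega
    have h1 : 0 < Real.log (4 * (3 ^ S * (Q.card : ℝ)) / δ) := by
      refine Real.log_pos ?_
      rw [lt_div_iff₀ hδ]
      linarith
    simp only [Nat.cast_zero, zero_div, zero_mul] at hlogD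
    linarith
  have hε := offDiag_threshold_le (B := B) (k := k) hn hδ hδ1 hM1 hSM
  obtain ⟨hlo, hup⟩ := eigenvalue_bounds o P hD hP hQ hS1 hne hα hΔ ρ (η := k / 4)
    (ε := k / 4 * B) (by linarith) (by linarith) (by positivity) (hcount hlogD) hmin.le
    (hoff.le.trans hε) hlam
  have hαm := alphaMin_pos (rows_nonempty hS1 hQ hne) hα
  obtain ⟨p, hp⟩ := rows_nonempty hS1 hQ hne
  have hαM : 0 < alphaMax Q S α := (hα p hp).trans_le (alpha_bounds hp).2
  set r : ℝ := ((3 : ℝ) ^ S - 1) / 3 ^ S with hr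
  have hre : r = 1 - 1 / 3 ^ S := by rw [hr]; field_simp
  have hr0 : 0 ≤ r := div_nonneg (by linarith) (by positivity)
  have hr1 : r ≤ 1 := by
    rw [hre]
    have : (0 : ℝ) ≤ 1 / 3 ^ S := by positivity
    linarith
  obtain ⟨a⟩ : Nonempty (Fin n) := ⟨⟨0, by omega⟩⟩
  have hAA : A ≤ colMax Q S α ρ := (colMin_le ρ a).trans (le_colMax ρ a)
  have hBB : B ≤ colMax Q S α ρ ^ 2 := pow_le_pow_left₀ hmin.le hAA 2
  obtain ⟨h1, h2, h3⟩ := relative_error_bounds hk hk1 hr0 hr1 hΔ.le hαm.le hBpos.le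
    (sq_nonneg (specNorm (observable o))) hαM.le hBB hlo hup
  refine ⟨h1, fun hor => h2 ?_, h3⟩
  have h2k : 2 / k ≤ (3 : ℝ) ^ S := by
    rcases hor with h | h
    · exact two_div_le_pow hn hBpos hδ hδ1 hk hk1 hQpos hBn hS' h
    · exact h
  rw [hre]
  have : 1 / (3 : ℝ) ^ S ≤ k / 2 := by
    rw [div_le_iff₀ (by positivity)]
    rw [div_le_iff₀ hk] at h2k
    linarith
  linarith

end QNTK

/-! ### Assembly of the probability bound -/

theorem mainTheorem6 :
    ∃ (n₀ : ℕ) (C₁ C₂ : ℝ), 0 < C₁ ∧ 0 < C₂ ∧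
      ∀ (n : ℕ), n₀ ≤ n →
      ∀ (N S D : ℕ) (o : Fin N → ℝ) (Q : Finset (Finset (Fin N)))
        (α : QNTK.PauliString N → ℝ)
        {Ω : Type*} [MeasurableSpace Ω] (μ : Measure Ω) [IsProbabilityMeasure μ]
        (ρ : Fin n → Ω → QNTK.QMat N) (P : Fin D → Ω → QNTK.PauliString N),
        1 ≤ S → Q.Nonempty → (∀ s ∈ Q, s.card = S) →
        0 < QNTK.Delta o S →
        (∀ p ∈ QNTK.rows Q S, 0 < α p) →
        QNTK.IsUncorrelatedEnsemble μ ρ α →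
        QNTK.IsRandomCircuit μ Q S P →
        IndepFun (fun ω => fun a x y => ρ a ω x y) (fun ω => fun d => P d ω) μ →
        ∀ (δ k : ℝ), 0 < δ → δ < 1 → 0 < k → k < 1 →
          ENNReal.ofReal (1 - δ) ≤ μ {ω |
            QNTK.SizeConditions C₁ C₂ δ k D o Q S α (fun a => ρ a ω) →
            ∀ lam : ℝ,
              Module.End.HasEigenvalue (Matrix.toLin' (QNTK.qntk (QNTK.observable o)
                (fun d => QNTK.pauliTensor (P d ω)) (fun a => ρ a ω) 0)) lam →
              (1 - k) * (((3 : ℝ) ^ S - 1) / 3 ^ S) * QNTK.Delta o S * QNTK.alphaMin Q S α *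
                  QNTK.colMin Q S α (fun a => ρ a ω) ^ 2 ≤ lam ∧
              ((Q.card : ℝ) ≤ (n : ℝ) ^ 2 * Real.log n ∨ 2 / k ≤ (3 : ℝ) ^ S →
                (1 - k) * QNTK.Delta o S * QNTK.alphaMin Q S α *
                  QNTK.colMin Q S α (fun a => ρ a ω) ^ 2 ≤ lam) ∧
              lam ≤ (1 + k) * QNTK.specNorm (QNTK.observable o) ^ 2 * QNTK.alphaMax Q S α *
                  QNTK.colMax Q S α (fun a => ρ a ω) ^ 2} := by
  refine ⟨5, 8, 3276800, by norm_num, by norm_num, ?_⟩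
  intro n hn N S D o Q α Ω _ μ _ ρ P hS hne hQ hΔ hα hρ hP _ δ k hδ hδ1 hk hk1
  set M0 : ℝ := 3 ^ S * Q.card with hM0
  have hQpos : (0 : ℝ) < Q.card := by exact_mod_cast hne.card_pos
  have hM0pos : 0 < M0 := by positivity
  have hMpos : (0 : ℝ) < (QNTK.rows Q S).card := by
    exact_mod_cast (QNTK.rows_nonempty hS hQ hne).card_pos
  have hnpos : (0 : ℝ) < n := by exact_mod_cast (by omega : 0 < n)
  -- the exceptional events: uneven use of the gates, large inner products of the columns of the
  -- normalised coefficient matrix, and columns that are all large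
  set E₁ : Set Ω := {ω | Real.log (4 * M0 / δ) ≤ D / M0 * (k / 4) ^ 2 / 4 ∧
    ∃ p, QNTK.supp p ∈ Q ∧ k / 4 * (D / M0) ≤
      |((Finset.univ.filter fun d => P d ω = p).card : ℝ) - D / M0|} with hE₁
  set E₂ : Set Ω := {ω | 4 * (n : ℝ) ^ 2 * (QNTK.rows Q S).card / δ ≤
    ∑ a, ∑ b ∈ Finset.univ.erase a, QNTK.gram Q S α (fun a => ρ a ω) a b ^ 2} with hE₂
  set E₃ : Set Ω := {ω | 4 / δ ≤
    ∏ a, QNTK.gram Q S α (fun a => ρ a ω) a a / (QNTK.rows Q S).card} with hE₃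
  have h₁ : μ.real E₁ ≤ δ / 2 := by
    by_cases hD : Real.log (4 * M0 / δ) ≤ D / M0 * (k / 4) ^ 2 / 4
    · have hle : E₁ ⊆ _ := fun ω hω => hω.2
      refine (measureReal_mono hle (measure_ne_top μ _)).trans
        ((QNTK.measure_exists_count_deviation_le hP hQ (by linarith : 0 < k / 4)
          (by linarith)).trans ?_)
      rw [← hM0]
      have hexp : Real.exp (-(D / M0 * (k / 4) ^ 2 / 4)) ≤ δ / (4 * M0) := by
        calc _ ≤ Real.exp (-Real.log (4 * M0 / δ)) := by gcongr
          _ = _ := by rw [Real.exp_neg, Real.exp_log (by positivity), inv_div]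
      calc M0 * (2 * Real.exp (-(D / M0 * (k / 4) ^ 2 / 4)))
          ≤ M0 * (2 * (δ / (4 * M0))) := by gcongr
        _ = δ / 2 := by field_simp; norm_num
    · have : E₁ = ∅ := Set.eq_empty_of_forall_notMem fun ω hω => hD hω.1
      rw [this, measureReal_empty]
      linarith
  have h₂ : μ.real E₂ ≤ δ / 4 := by
    refine (QNTK.measure_offDiag_gram_le hS hQ hα hρ (by positivity)).trans (le_of_eq ?_)
    field_simp
  have h₃ : μ.real E₃ ≤ δ / 4 := by
    refine (QNTK.measure_prod_gram_le hS hQ hne hα hρ (by positivity)).trans (le_of_eq ?_)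
    field_simp
  have hE : μ.real (E₁ ∪ E₂ ∪ E₃) ≤ δ := by
    have h1 := measureReal_union_le (μ := μ) (E₁ ∪ E₂) E₃
    have h2 := measureReal_union_le (μ := μ) E₁ E₂
    linarith
  rw [← ofReal_measureReal]
  refine ENNReal.ofReal_le_ofReal ?_
  have hcover : 1 ≤ μ.real (E₁ ∪ E₂ ∪ E₃) + μ.real (E₁ ∪ E₂ ∪ E₃)ᶜ := by
    have h := measureReal_union_le (μ := μ) (E₁ ∪ E₂ ∪ E₃) (E₁ ∪ E₂ ∪ E₃)ᶜ
    rwa [Set.union_compl_self, probReal_univ] at h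
  refine le_trans (by linarith : 1 - δ ≤ μ.real (E₁ ∪ E₂ ∪ E₃)ᶜ)
    (measureReal_mono ?_ (measure_ne_top μ _))
  intro ω hω hsize lam hlam
  simp only [Set.compl_union, Set.mem_inter_iff, Set.mem_compl_iff, hE₁, hE₂, hE₃,
    Set.mem_ofPred_eq, not_and, not_exists, not_le] at hω
  exact QNTK.eigenvalue_bounds_of_sizeConditions hn o (fun d => P d ω) hS hne hQ hΔ hα
    (fun d => hP.supp_mem d ω) (fun a => ρ a ω) hδ hδ1 hk hk1
    (fun hD p hp => (hω.1.1 hD p hp).le) hω.2 hω.1.2 hsize hlam
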